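/- Conventions. TST is the many-sorted theory with types $0,1,2,\dots$, equality between objects of equal type, and membership of objects of type $i$ in objects of type $i+1$; $\mathrm{TST}_n$ uses the types $0,\dots,n-1$ only. For a sentence $\phi$ of TST, $\phi^+$ is obtained by raising every type by $1$. NF (New Foundations) is the one-sorted theory with axioms of extensionality and comprehension $\exists A\,\forall x\,(x\in A\leftrightarrow\phi)$ (universally closed, $A$ not occurring in $\phi$) for every $\phi$ obtained from a formula of TST by forgetting the types of the variables (equivalently, for every stratified $\phi$). The natural model of TST (or $\mathrm{TST}_n$) with base set $X$ has $\mathcal P^i(X)$ as type $i$ and true membership. Let $M$ be a model of set theory without Choice: it suffices that $M$ satisfies extensionality (for sets; atoms are allowed), pairing, union, power set and $\Delta_0$ separation, so $M$ may be a model of Mac Lane set theory, Zermelo set theory, ZF or ZFA, each with or without Choice. The notions of the next paragraph (ordinals, finiteness, bijections, power sets, natural models) are those of $M$, and a cardinal of $M$ is the equinumerosity class of a set of $M$. Let $\lambda$ be a limit ordinal. For a nonempty finite set $A\subseteq\lambda$ let $A_0=A$, $A_1=A\setminus\{\min A\}$ and $A_{n+1}=(A_n)_1$ as long as $A_n\neq\emptyset$.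 A tangled web of cardinals is a function $\tau$ from the nonempty finite subsets of $\lambda$ to cardinals such that (naturality) $2^{\tau(A)}=\tau(A_1)$ whenever $|A|\ge 2$; and (elementarity) for every natural number $n$, if $|A|,|B|>n$ and $A\setminus A_n=B\setminus B_n$ (that is, $A$ and $B$ have the same $n$ least elements), then the natural models of $\mathrm{TST}_n$ with base sets of cardinality $\tau(A)$ and $\tau(B)$ have the same first-order theory. The function $\tau$ need not be an element of $M$, and elementarity is only required for standard natural numbers $n$ and standard sentences, so every $\tau$ that is a tangled web according to $M$ is included. Theorem. If $M$ has a tangled web of cardinals $\tau$, then (a) for every finite set $\Sigma$ of sentences of TST there are a nonempty finite $A\subseteq\lambda$ and a set $X$ of cardinality $\tau(A)$ such that the natural model of TST with base set $X$ satisfies $\phi\leftrightarrow\phi^+$ for all $\phi\in\Sigma$; and (b) NF is consistent, that is, NF has a model. In particular, if set theory with the assumption that there is a tangled web of cardinals is consistent, then so is NF. -/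

import Mathlib

namespace TangledWeb

open FirstOrder

universe u

/-! ### Typed formulas: the language of TST -/

/-- Formulas of the language of the simple theory of types TST. A formula lives in a context of
`m` variables, the variable `x : Fin m` having type `Γ x`. Equality needs equal types, membership
needs the type of the right-hand variable to be the successor of the type of the left-hand one.
The quantifier `all i φ` binds one further variable, of type `i`, which is the last variable of the
context of `φ`. The other connectives are defined from `falsum`, `imp` and `all` classically. -/
inductive TSTFormula : {m : ℕ} → (Fin m → ℕ) → Type
  | falsum {m : ℕ} {Γ : Fin m → ℕ} : TSTFormula Γ
  | equal {m : ℕ} {Γ : Fin m → ℕ} (x y : Fin m) (h : Γ x = Γ y) : TSTFormula Γ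
  | mem {m : ℕ} {Γ : Fin m → ℕ} (x y : Fin m) (h : Γ x + 1 = Γ y) : TSTFormula Γ
  | imp {m : ℕ} {Γ : Fin m → ℕ} (φ ψ : TSTFormula Γ) : TSTFormula Γ
  | all {m : ℕ} {Γ : Fin m → ℕ} (i : ℕ)
      (φ : TSTFormula (Fin.snoc (α := fun _ => ℕ) Γ i)) : TSTFormula Γ

/-- Sentences of TST: formulas without free variables. -/
abbrev TSTSentence : Type := TSTFormula (Fin.elim0 : Fin 0 → ℕ)

/-- Only quantifiers over types `< n` occur. A sentence of TST with this property is exactly a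
sentence of `TST_n`. -/
def TSTFormula.TypesLT (n : ℕ) : {m : ℕ} → {Γ : Fin m → ℕ} → TSTFormula Γ → Prop
  | _, _, .falsum => True
  | _, _, .equal _ _ _ => True
  | _, _, .mem _ _ _ => True
  | _, _, .imp φ ψ => φ.TypesLT n ∧ ψ.TypesLT n
  | _, _, .all i φ => i < n ∧ φ.TypesLT n

/-- Type raising `φ ↦ φ⁺`: every variable of type `i` becomes a variable of type `i + 1`. -/
def TSTFormula.raise : {m : ℕ} → {Γ : Fin m → ℕ} → TSTFormula Γ →
    (Δ : Fin m → ℕ) → (∀ x, Δ x = Γ x + 1) → TSTFormula Δ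
  | _, _, .falsum, _, _ => .falsum
  | _, _, .equal x y h, _, hΔ => .equal x y (by rw [hΔ, hΔ, h])
  | _, _, .mem x y h, _, hΔ => .mem x y (by rw [hΔ, hΔ, h])
  | _, _, .imp φ ψ, Δ, hΔ => .imp (φ.raise Δ hΔ) (ψ.raise Δ hΔ)
  | _, _, .all i φ, Δ, hΔ => .all (i + 1) (φ.raise (Fin.snoc (α := fun _ => ℕ) Δ (i + 1)) (by
      intro x
      refine Fin.lastCases ?_ (fun y => ?_) x
      · simp
      · simp [hΔ]))

/-- Type raising on sentences. -/
def TSTSentence.plus (φ : TSTSentence) : TSTSentence :=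
  TSTFormula.raise φ _ (fun x => x.elim0)

/-! ### New Foundations -/

/-- The only non-logical symbol of NF: a binary relation symbol `∈`. -/
inductive NFRel : ℕ → Type
  | mem : NFRel 2

/-- The one-sorted language of NF (equality is a logical symbol). -/
def nfLang : FirstOrder.Language.{0, 0} := ⟨fun _ => Empty, NFRel⟩

/-- The symbol `∈` of NF. -/
def nfMemSymbol : nfLang.Relations 2 := NFRel.mem

/-- The atomic formula `s ∈ t` of NF. -/
def nfMem {m : ℕ} (s t : nfLang.Term (Empty ⊕ Fin m)) : nfLang.BoundedFormula Empty m :=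
  nfMemSymbol.boundedFormula₂ s t

/-- Forget the types of the variables. The formulas of NF obtained in this way are the stratified
ones. -/
def TSTFormula.erase : {m : ℕ} → {Γ : Fin m → ℕ} → TSTFormula Γ → nfLang.BoundedFormula Empty m
  | _, _, .falsum => ⊥
  | _, _, .equal x y _ =>
      Language.Term.bdEqual (Language.Term.var (Sum.inr x)) (Language.Term.var (Sum.inr y))
  | _, _, .mem x y _ => nfMem (Language.Term.var (Sum.inr x)) (Language.Term.var (Sum.inr y))
  | _, _, .imp φ ψ => φ.erase.imp ψ.erase
  | _, _, .all _ φ => φ.erase.all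

/-- Extensionality: `∀ x y, x = y ↔ ∀ z, z ∈ x ↔ z ∈ y`. -/
def nfExtensionality : nfLang.Sentence :=
  Language.BoundedFormula.alls (n := 2)
    ((Language.Term.bdEqual (Language.Term.var (Sum.inr 0)) (Language.Term.var (Sum.inr 1))).iff
      (Language.BoundedFormula.all
        ((nfMem (m := 3) (Language.Term.var (Sum.inr 2)) (Language.Term.var (Sum.inr 0))).iff
          (nfMem (Language.Term.var (Sum.inr 2)) (Language.Term.var (Sum.inr 1))))))

/-- Comprehension for the typed formula `φ`, whose variables are the parameters `0, …, m - 1` and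
the variable `x` with index `m`: the universal closure of `∃ A, ∀ x, x ∈ A ↔ φ`, types erased.
In the context of the matrix, `A` has index `m` and `x` has index `m + 1`; so `φ` is renamed along
the increasing map `Fin (m + 1) → Fin (m + 2)` that omits `m`, and `A` does not occur in it. -/
def nfComprehension {m : ℕ} {Γ : Fin (m + 1) → ℕ} (φ : TSTFormula Γ) : nfLang.Sentence :=
  Language.BoundedFormula.alls (n := m)
    (Language.BoundedFormula.ex (Language.BoundedFormula.all
      ((nfMem (m := m + 2) (Language.Term.var (Sum.inr (Fin.last (m + 1))))
          (Language.Term.var (Sum.inr (Fin.last m).castSucc))).iff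
        (Language.BoundedFormula.relabel (n := m + 2) (k := 0)
          (Sum.map id (Fin.succAbove (Fin.last m).castSucc)) φ.erase.toFormula))))

/-- Quine's New Foundations: extensionality and stratified comprehension. -/
def NF : nfLang.Theory :=
  {nfExtensionality} ∪
    {σ | ∃ (m : ℕ) (Γ : Fin (m + 1) → ℕ) (φ : TSTFormula Γ), σ = nfComprehension φ}

/-! ### Set theory without choice -/

/-- The symbols of set theory with atoms: membership, and the predicate of being a set. -/
inductive SetRel : ℕ → Type
  | mem : SetRel 2
  | isSet : SetRel 1

/-- The language of set theory with atoms. -/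
def setLang : FirstOrder.Language.{0, 0} := ⟨fun _ => Empty, SetRel⟩

/-- The symbol `∈` of set theory. -/
def memSymbol : setLang.Relations 2 := SetRel.mem

/-- The predicate symbol of being a set. -/
def isSetSymbol : setLang.Relations 1 := SetRel.isSet

/-- `Δ₀` formulas: those all of whose quantifiers are bounded, `∀ x ∈ y` with `y` a variable.
Bounded existential quantifiers arise as negations. -/
inductive IsDeltaZero {α : Type} : {n : ℕ} → setLang.BoundedFormula α n → Prop
  | falsum {n : ℕ} : IsDeltaZero (⊥ : setLang.BoundedFormula α n)
  | equal {n : ℕ} (s t : setLang.Term (α ⊕ Fin n)) : IsDeltaZero (Language.Term.bdEqual s t)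
  | rel {n l : ℕ} (R : setLang.Relations l) (ts : Fin l → setLang.Term (α ⊕ Fin n)) :
      IsDeltaZero (Language.Relations.boundedFormula R ts)
  | imp {n : ℕ} {φ ψ : setLang.BoundedFormula α n} :
      IsDeltaZero φ → IsDeltaZero ψ → IsDeltaZero (φ.imp ψ)
  | ball {n : ℕ} (y : α ⊕ Fin n) {φ : setLang.BoundedFormula α (n + 1)} :
      IsDeltaZero φ →
      IsDeltaZero (Language.BoundedFormula.all
        ((memSymbol.boundedFormula₂ (n := n + 1)
          (Language.Term.var (Sum.inr (Fin.last n)))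
          (Language.Term.var (Sum.map id Fin.castSucc y))).imp φ))

variable {M : Type u} [setLang.Structure M]

/-- The membership relation of the structure `M`. -/
def Mem (x y : M) : Prop := Language.Structure.RelMap memSymbol ![x, y]

/-- `x` is a set (not an atom) in the sense of `M`. -/
def IsSet (x : M) : Prop := Language.Structure.RelMap isSetSymbol ![x]

infix:50 " ∈ₘ " => Mem

/-- `d = {x, y}` in `M`. -/
def IsUPair (d x y : M) : Prop := IsSet d ∧ ∀ z, z ∈ₘ d ↔ z = x ∨ z = y

/-- `p` is the power set of `x` in `M`. -/
def IsPowerset (p x : M) : Prop := IsSet p ∧ ∀ z, z ∈ₘ p ↔ IsSet z ∧ ∀ w, w ∈ₘ z → w ∈ₘ x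

variable (M) in
/-- `M` is a model of set theory: extensionality, pairing, union, power set and `Δ₀` separation
(with parameters). Atoms are allowed but need not exist. Choice, foundation, replacement and full
separation are not required (and infinity will follow from the presence of a limit ordinal), so
every model of ZF, of ZFA, of Zermelo set theory or of Mac Lane set theory (each with or without
choice) is a model in this sense. -/
structure IsSetTheoryModel : Prop where
  isSet_of_mem : ∀ x y : M, x ∈ₘ y → IsSet y
  extensionality : ∀ x y : M, IsSet x → IsSet y → (∀ z, z ∈ₘ x ↔ z ∈ₘ y) → x = y
  pairing : ∀ x y : M, ∃ d, IsUPair d x y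
  union : ∀ x : M, ∃ s, IsSet s ∧ ∀ z, z ∈ₘ s ↔ ∃ y, y ∈ₘ x ∧ z ∈ₘ y
  powerset : ∀ x : M, ∃ p, IsPowerset p x
  separation : ∀ φ : setLang.Formula ℕ, IsDeltaZero φ → ∀ (v : ℕ → M) (a : M),
    ∃ b, IsSet b ∧ ∀ x, x ∈ₘ b ↔ x ∈ₘ a ∧ φ.Realize (Function.update v 0 x)

/-! ### Cardinals of `M` -/

/-- `p = (x, y) = {{x}, {x, y}}` in `M`. -/
def IsOPair (p x y : M) : Prop := ∃ s d, IsUPair s x x ∧ IsUPair d x y ∧ IsUPair p s d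

/-- `x` and `y` are equinumerous in `M`: some element `f` of `M` is a bijection from `x` to `y`. -/
def Equinumerous (x y : M) : Prop :=
  ∃ f : M, (∀ a, a ∈ₘ x → ∃! b, b ∈ₘ y ∧ ∃ p, p ∈ₘ f ∧ IsOPair p a b) ∧
    (∀ b, b ∈ₘ y → ∃! a, a ∈ₘ x ∧ ∃ p, p ∈ₘ f ∧ IsOPair p a b)

/-- The cardinal of `x` in `M`, as the class of all sets of `M` equinumerous with `x` in `M`.
No well-ordering is involved. (Where Scott's cardinals exist in `M`, they correspond one-to-one to
these classes, a Scott cardinal being the set of the members of least rank of such a class.) -/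
def card (x : M) : Set M := {y | IsSet y ∧ Equinumerous x y}

/-- `κ` is a cardinal of `M`. -/
def IsCardinal (κ : Set M) : Prop := ∃ x : M, IsSet x ∧ κ = card x

/-- `2 ^ κ`, the cardinal of the power set of any set of cardinality `κ`. -/
def twoPow (κ : Set M) : Set M := {z | ∃ x ∈ κ, ∃ p, IsPowerset p x ∧ z ∈ card p}

/-! ### Ordinals and extended type indices of `M` -/

/-- `α` is a von Neumann ordinal of `M`: a transitive set of sets, well-ordered by membership. -/
structure IsOrdinal (α : M) : Prop where
  isSet : IsSet α
  isSet_of_mem : ∀ x, x ∈ₘ α → IsSet x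
  transitive : ∀ x y, x ∈ₘ y → y ∈ₘ α → x ∈ₘ α
  total : ∀ x y, x ∈ₘ α → y ∈ₘ α → x ∈ₘ y ∨ x = y ∨ y ∈ₘ x
  wellFounded : ∀ s : M, (∃ x, x ∈ₘ s) → (∀ x, x ∈ₘ s → x ∈ₘ α) →
    ∃ x, x ∈ₘ s ∧ ∀ y, y ∈ₘ s → ¬ y ∈ₘ x

/-- `l` is a limit ordinal of `M` (nonzero and not a successor). -/
def IsLimitOrdinal (l : M) : Prop :=
  IsOrdinal l ∧ (∃ x, x ∈ₘ l) ∧ ∀ x, x ∈ₘ l → ∃ y, y ∈ₘ l ∧ x ∈ₘ y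

/-- `A` is a finite set in `M`, by Tarski's definition (equivalent, without choice, to being
equinumerous with a natural number): every nonempty set of subsets of `A` has a minimal element. -/
def IsFiniteSet (A : M) : Prop :=
  IsSet A ∧ ∀ F : M, (∃ s, s ∈ₘ F) → (∀ s, s ∈ₘ F → IsSet s ∧ ∀ x, x ∈ₘ s → x ∈ₘ A) →
    ∃ s, s ∈ₘ F ∧ ∀ t, t ∈ₘ F → (∀ x, x ∈ₘ t → x ∈ₘ s) → t = s

/-- The extended type indices: nonempty finite subsets of the limit ordinal `l`, in `M`. -/
def IsIndex (l A : M) : Prop :=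
  IsFiniteSet A ∧ (∃ x, x ∈ₘ A) ∧ ∀ x, x ∈ₘ A → x ∈ₘ l

/-- The number of elements of `A`, counted outside `M`. Only comparisons with actual natural
numbers are made, and these agree with the comparisons made in `M`. -/
noncomputable def size (A : M) : ℕ∞ := Set.encard {x : M | x ∈ₘ A}

/-- `B = A \ {min A}`, that is, `B = A₁`. -/
def IsTail (B A : M) : Prop :=
  ∃ k, (k ∈ₘ A ∧ ∀ x, x ∈ₘ A → x = k ∨ k ∈ₘ x) ∧ IsSet B ∧ ∀ x, x ∈ₘ B ↔ x ∈ₘ A ∧ x ≠ k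

/-- `B = Aₙ`, where `A₀ = A` and `Aₙ₊₁ = (Aₙ)₁`. -/
def IsIterTail : ℕ → M → M → Prop
  | 0, B, A => B = A
  | n + 1, B, A => ∃ C, IsIterTail n C A ∧ IsTail B C

/-! ### Natural models of TST in `M` -/

/-- `a` is an object of type `i` of the natural model with base set `X`: type `0` is `X` and type
`i + 1` is the power set, in `M`, of type `i`. -/
def NatType (X : M) : ℕ → M → Prop
  | 0, a => a ∈ₘ X
  | i + 1, a => IsSet a ∧ ∀ b, b ∈ₘ a → NatType X i b

/-- Truth of a formula of TST in the natural model with base set `X`, whose membership relations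
are restrictions of the membership relation of `M`. -/
def NatRealize (X : M) : {m : ℕ} → {Γ : Fin m → ℕ} → TSTFormula Γ → (Fin m → M) → Prop
  | _, _, .falsum, _ => False
  | _, _, .equal x y _, v => v x = v y
  | _, _, .mem x y _, v => v x ∈ₘ v y
  | _, _, .imp φ ψ, v => NatRealize X φ v → NatRealize X ψ v
  | _, _, .all i φ, v => ∀ a, NatType X i a → NatRealize X φ (Fin.snoc (α := fun _ => M) v a)

/-- Truth of a sentence of TST in the natural model with base set `X`. -/
def NatModels (X : M) (φ : TSTSentence) : Prop := NatRealize X φ Fin.elim0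

/-- The first-order theory of the natural model of `TST_n` with base set `X`. -/
def natTheory (n : ℕ) (X : M) : Set TSTSentence := {φ | φ.TypesLT n ∧ NatModels X φ}

/-! ### Tangled webs -/

/-- `τ` is a tangled web of cardinals in `M`, indexed by the nonempty finite subsets of the limit
ordinal `l` of `M` (values of `τ` elsewhere are irrelevant). It is not required that `τ` be
given by an element of `M`, and elementarity is required for actual natural numbers and actual
sentences only; so whatever is a tangled web according to `M` is a tangled web in this sense. -/
structure IsTangledWeb (l : M) (τ : M → Set M) : Prop where
  isLimitOrdinal : IsLimitOrdinal l
  isCardinal : ∀ A, IsIndex l A → IsCardinal (τ A)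
  naturality : ∀ A B, IsIndex l A → 2 ≤ size A → IsTail B A → twoPow (τ A) = τ B
  elementarity : ∀ (n : ℕ) (A A' B B' : M), IsIndex l A → IsIndex l B →
    (n : ℕ∞) < size A → (n : ℕ∞) < size B →
    IsIterTail n A' A → IsIterTail n B' B →
    (∀ x, (x ∈ₘ A ∧ ¬ x ∈ₘ A') ↔ (x ∈ₘ B ∧ ¬ x ∈ₘ B')) →
    ∀ X ∈ τ A, ∀ Y ∈ τ B, natTheory n X = natTheory n Y

end TangledWeb

/-!
The proof has two halves.

*Ambiguity for finitely many sentences.* Let the sentences use only types below `n`. By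
elementarity, which of them hold in the natural model on `τ A` depends only on the `n` least
elements of `A` (as long as `A` has more elements), so this is a finite colouring of the
`n`-element sets of ordinals below the limit ordinal. Full homogeneity is not needed: it is enough
to have `n + 1` ordinals whose first `n` and last `n` have the same colour, and such a sequence is
built along an ultrafilter of final segments (`exists_list_colour_tail_eq`). If `A` consists of such
a sequence and one larger ordinal, then naturality says that the power set `P` of a set `X` of
cardinality `τ A` has cardinality `τ A₁`. The natural models on `X` and on `P` agree on the given
sentences, and truth of `φ⁺` on `X` is truth of `φ` on `P` (`natModels_plus`). No properties of
equinumerosity beyond reflexivity are needed, because elementarity speaks of all sets of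
cardinality `τ A`.

*From ambiguity to NF* (Specker's theorem). Choose natural models on `X n` satisfying ambiguity for
more and more of the countably many sentences. In an ultraproduct over `ℕ` ambiguity holds for all
sentences, so the empty map is a partial elementary map from the ultraproduct to its shift, the
ultraproduct of the natural models on the power sets of the `X n`. A countable ultraproduct is
countably saturated (`exists_forall_eventually`), so countable partial elementary maps have the
back-and-forth property. Therefore a given object of type `i` can be put into a *thread*, a sequence
of objects `d 0, d 1, …` of types `0, 1, …` such that `d j ↦ d (j + 1)` extends a given countable
partial elementary map (`IsPartialElementary.exists_thread`). A Henkin construction of length `ω`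
yields countably many threads that witness all existential statements about them
(`exists_isHenkin`). The threads, with `c ∈ d` if and only if `c 0 ∈ d 1`, form a model of NF: since
the map sending `c j` to `c (j + 1)` is elementary, membership may be read off at any pair of
consecutive types, so a stratified formula holds of threads exactly if the typed formula holds of
their members (`Represents.realize_erase`). Extensionality and comprehension thus follow from the
same properties of the natural models; comprehension there is `Δ₀` separation with the sets of
objects of the various types as parameters (`IsSetTheoryModel.natModel_comprehension`).
-/

namespace TangledWeb

open FirstOrder

universe u

variable {M : Type u} [setLang.Structure M]

/-! ### Sets of the model -/

theorem realize_mem {α : Type} {n : ℕ} (s t : setLang.Term (α ⊕ Fin n)) (v : α → M)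
    (xs : Fin n → M) : (memSymbol.boundedFormula₂ s t).Realize v xs ↔
      s.realize (Sum.elim v xs) ∈ₘ t.realize (Sum.elim v xs) :=
  Language.BoundedFormula.realize_rel₂

theorem IsSetTheoryModel.exists_ofList (hM : IsSetTheoryModel M) (z : M) (s : List M) :
    ∃ A : M, IsSet A ∧ ∀ x, x ∈ₘ A ↔ x ∈ s := by
  induction s with
  | nil =>
    obtain ⟨b, hb, h⟩ := hM.separation ⊥ IsDeltaZero.falsum (fun _ => z) z
    refine ⟨b, hb, fun x => ?_⟩
    rw [h]
    simp [Language.Formula.Realize]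
  | cons a s ih =>
    obtain ⟨B, -, hB⟩ := ih
    obtain ⟨d, -, hd⟩ := hM.pairing a a
    obtain ⟨e, -, he⟩ := hM.pairing d B
    obtain ⟨A, hA, h⟩ := hM.union e
    refine ⟨A, hA, fun x => ?_⟩
    rw [h]
    simp [he, or_and_right, exists_or, hd, hB]

/-- The identity map is a set of the model: among the sets of subsets of `x`, take those with at
most one member; such a set is an ordered pair `{{a}, {a, b}}` only if `a = b`. -/
theorem IsSetTheoryModel.equinumerous_refl (hM : IsSetTheoryModel M) (x : M) :
    Equinumerous x x := by
  obtain ⟨p, -, hp⟩ := hM.powerset x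
  obtain ⟨q, -, hq⟩ := hM.powerset p
  obtain ⟨f, -, hf⟩ := hM.separation _
    (IsDeltaZero.ball (n := 0) (Sum.inl 0) (IsDeltaZero.ball (n := 1) (Sum.inl 0)
      (IsDeltaZero.equal (α := ℕ) (Language.Term.var (Sum.inr 0))
        (Language.Term.var (Sum.inr 1))))) (fun _ => x) q
  have hf' : ∀ r, r ∈ₘ f ↔ r ∈ₘ q ∧ ∀ s, s ∈ₘ r → ∀ t, t ∈ₘ r → s = t := by
    intro r
    rw [hf]
    simp only [Language.Formula.Realize, Language.BoundedFormula.realize_all,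
      Language.BoundedFormula.realize_imp, realize_mem]
    exact Iff.rfl
  have key : ∀ a b, a ∈ₘ x → ((∃ r, r ∈ₘ f ∧ IsOPair r a b) ↔ b = a) := by
    intro a b ha
    constructor
    · rintro ⟨r, hr, s, d, hs, hd, hrsd⟩
      have hsd : s = d := ((hf' r).1 hr).2 s ((hrsd.2 s).2 (Or.inl rfl)) d
        ((hrsd.2 d).2 (Or.inr rfl))
      have hb : b ∈ₘ s := hsd ▸ (hd.2 b).2 (Or.inr rfl)
      simpa using (hs.2 b).1 hb
    · rintro rfl
      obtain ⟨s, hs⟩ := hM.pairing b b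
      obtain ⟨r, hr⟩ := hM.pairing s s
      refine ⟨r, (hf' r).2 ⟨(hq r).2 ⟨hr.1, fun t ht => ?_⟩, fun t ht t' ht' => ?_⟩,
        s, s, hs, hs, hr⟩
      · obtain rfl : t = s := by simpa using (hr.2 t).1 ht
        refine (hp t).2 ⟨hs.1, fun w hw => ?_⟩
        obtain rfl : w = b := by simpa using (hs.2 w).1 hw
        exact ha
      · have h1 : t = s := by simpa using (hr.2 t).1 ht
        have h2 : t' = s := by simpa using (hr.2 t').1 ht'
        rw [h1, h2]
  refine ⟨f, fun a ha => ⟨a, ⟨ha, (key a a ha).2 rfl⟩, fun b hb => (key a b ha).1 hb.2⟩,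
    fun b hb => ⟨b, ⟨hb, (key b b hb).2 rfl⟩, fun a ha => ((key a b ha.1).1 ha.2).symm⟩⟩

theorem IsSetTheoryModel.mem_card_self (hM : IsSetTheoryModel M) {x : M} (hx : IsSet x) :
    x ∈ card x :=
  ⟨hx, hM.equinumerous_refl x⟩

/-- A set with finitely many members is finite in the sense of the model: a member of least
cardinality of a family of subsets is minimal. -/
theorem IsSetTheoryModel.isFiniteSet_of_list (hM : IsSetTheoryModel M) {A : M} {s : List M}
    (hA : IsSet A) (hs : ∀ x, x ∈ₘ A ↔ x ∈ s) : IsFiniteSet A := by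
  refine ⟨hA, fun F hF hsub => ?_⟩
  have hfin : ∀ t, t ∈ₘ F → {x | x ∈ₘ t}.Finite := fun t ht =>
    s.finite_toSet.subset fun x hx => (hs x).1 ((hsub t ht).2 x hx)
  obtain ⟨t, ht, hmin⟩ : ∃ t, t ∈ₘ F ∧ ∀ t', t' ∈ₘ F →
      {x | x ∈ₘ t}.ncard ≤ {x | x ∈ₘ t'}.ncard := by
    obtain ⟨t, ht, h⟩ := WellFounded.has_min (measure fun t : M => {x | x ∈ₘ t}.ncard).wf
      {t | t ∈ₘ F} hF
    exact ⟨t, ht, fun t' ht' => not_lt.1 (h t' ht')⟩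
  refine ⟨t, ht, fun t' ht' hle => hM.extensionality _ _ (hsub t' ht').1 (hsub t ht).1 ?_⟩
  have := Set.eq_of_subset_of_ncard_le (s := {x | x ∈ₘ t'}) (t := {x | x ∈ₘ t}) hle
    (hmin t' ht') (hfin t ht)
  exact fun z => Set.ext_iff.1 this z

/-! ### Limit ordinals of the model -/

theorem IsOrdinal.not_mem_self (hM : IsSetTheoryModel M) {l x : M} (hl : IsOrdinal l)
    (hx : x ∈ₘ l) : ¬ x ∈ₘ x := by
  obtain ⟨s, -, hs⟩ := hM.exists_ofList x [x]
  obtain ⟨y, hy, h⟩ := hl.wellFounded s ⟨x, by simp [hs]⟩ (by simpa [hs] using hx)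
  obtain rfl : y = x := by simpa [hs] using hy
  exact h y hy

theorem IsOrdinal.mem_trans (hM : IsSetTheoryModel M) {l x y z : M} (hl : IsOrdinal l)
    (hz : z ∈ₘ l) (hxy : x ∈ₘ y) (hyz : y ∈ₘ z) : x ∈ₘ z := by
  have hy := hl.transitive y z hyz hz
  have hx := hl.transitive x y hxy hy
  -- A cycle `x ∈ y ∈ z ∈ x` or `y ∈ x ∈ y` contradicts foundation below `l`.
  obtain ⟨s, -, hs⟩ := hM.exists_ofList x [x, y, z]
  obtain ⟨w, hw, h⟩ := hl.wellFounded s ⟨x, by simp [hs]⟩ (by simp [hs, hx, hy, hz])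
  rcases hl.total x z hx hz with h1 | rfl | h1
  · exact h1
  · simp only [hs, List.mem_cons, List.not_mem_nil, or_false] at hw h
    rcases hw with rfl | rfl | rfl
    · exact absurd hyz (h y (by simp))
    · exact absurd hxy (h x (by simp))
    · exact absurd hyz (h y (by simp))
  · simp only [hs, List.mem_cons, List.not_mem_nil, or_false] at hw h
    rcases hw with rfl | rfl | rfl
    · exact absurd h1 (h z (by simp))
    · exact absurd hxy (h x (by simp))
    · exact absurd hyz (h y (by simp))

/-- The filter of final segments of a limit ordinal. -/
theorem IsLimitOrdinal.exists_filter (hM : IsSetTheoryModel M) {l : M} (hl : IsLimitOrdinal l) :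
    ∃ f : Filter {x // x ∈ₘ l}, f.NeBot ∧ ∀ a : {x // x ∈ₘ l}, ∀ᶠ x in f, a.1 ∈ₘ x.1 := by
  obtain ⟨ho, ⟨x₀, hx₀⟩, hlim⟩ := hl
  have : Nonempty {x // x ∈ₘ l} := ⟨⟨x₀, hx₀⟩⟩
  refine ⟨⨅ a : {x // x ∈ₘ l}, Filter.principal {x | a.1 ∈ₘ x.1}, ?_, fun a =>
    Filter.mem_iInf_of_mem a (Filter.mem_principal_self _)⟩
  refine Filter.iInf_neBot_of_directed' (fun a b => ?_) fun a => ?_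
  · rcases ho.total a.1 b.1 a.2 b.2 with h | h | h
    · exact ⟨b, Filter.principal_mono.2 fun x hx => ho.mem_trans hM x.2 h hx, le_rfl⟩
    · exact ⟨b, Filter.principal_mono.2 fun x hx => (show a.1 ∈ₘ x.1 from h ▸ hx), le_rfl⟩
    · exact ⟨a, le_rfl, Filter.principal_mono.2 fun x hx => ho.mem_trans hM x.2 h hx⟩
  · obtain ⟨y, hy, h⟩ := hlim a.1 a.2
    exact Filter.principal_neBot_iff.2 ⟨⟨y, hy⟩, h⟩

/-! ### A weak form of Ramsey's theorem -/

theorem exists_eventually_eq_of_finite {α κ : Type*} [Finite κ] (U : Ultrafilter α)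
    (f : α → κ) : ∃ c, ∀ᶠ x in U, f x = c := by
  obtain ⟨c, hc⟩ := (U.map f).eq_pure_of_finite
  refine ⟨c, ?_⟩
  have : {c} ∈ U.map f := by rw [hc]; exact Set.mem_singleton c
  exact this

/-- The iterated limit along `U` of a finite colouring: `limitColour U c k s` is the colour of
`x₁ :: … :: xₖ :: s` for almost all `xₖ`, for almost all `xₖ₋₁`, and so on. -/
noncomputable def limitColour {α κ : Type*} [Finite κ] (U : Ultrafilter α) (c : List α → κ) :
    ℕ → List α → κ
  | 0, s => c s
  | k + 1, s => (exists_eventually_eq_of_finite U fun x => limitColour U c k (x :: s)).choose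

theorem eventually_limitColour {α κ : Type*} [Finite κ] (U : Ultrafilter α) (c : List α → κ)
    (k : ℕ) (s : List α) :
    ∀ᶠ x in U, limitColour U c k (x :: s) = limitColour U c (k + 1) s :=
  (exists_eventually_eq_of_finite U fun x => limitColour U c k (x :: s)).choose_spec

/-- For every finite colouring of the descending sequences of length `n + 1` there is a descending
sequence of length `n + 2` whose first `n + 1` and last `n + 1` terms have the same colour. -/
theorem exists_list_colour_tail_eq {α κ : Type*} [Finite κ] (f : Filter α) [f.NeBot]
    (r : α → α → Prop) (hr : ∀ a, ∀ᶠ x in f, r x a) (c : List α → κ) (n : ℕ) :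
    ∃ (x : α) (s : List α), s.length = n + 1 ∧ (x :: s).Pairwise r ∧
      c s = c (x :: s.dropLast) := by
  let U := Ultrafilter.of f
  have hU : ∀ s : List α, ∀ᶠ x in U, ∀ a ∈ s, r x a := fun s => by
    have := (Filter.eventually_all_finite s.finite_toSet (l := f) (p := fun a x => r x a)).2
      fun a _ => hr a
    exact this.filter_mono (Ultrafilter.of_le f)
  -- `q` is the limit colour of all sequences of length `n + 1`; every partial sequence built below
  -- and the same sequence without its least term have the limit colour `q`.
  set q := limitColour U c (n + 1) []
  have main : ∀ j k, j + k = n → ∃ s : List α, s.length = j + 1 ∧ s.Pairwise r ∧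
      limitColour U c k s = q ∧ limitColour U c (k + 1) s.dropLast = q := by
    intro j
    induction j with
    | zero =>
      rintro k hk
      obtain rfl : k = n := by omega
      obtain ⟨x, h⟩ := (eventually_limitColour U c k []).exists
      exact ⟨[x], rfl, by simp, h, rfl⟩
    | succ j ih =>
      intro k hk
      obtain ⟨s, h1, h2, h3, h4⟩ := ih (k + 1) (by omega)
      -- the next term is chosen for `s` and for `s.dropLast` at once
      have hne : s ≠ [] := by rintro rfl; simp at h1
      obtain ⟨x, ⟨hx1, hx2⟩, hx3⟩ := (((hU s).and (eventually_limitColour U c k s)).and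
        (eventually_limitColour U c (k + 1) s.dropLast)).exists
      refine ⟨x :: s, by simp [h1], List.pairwise_cons.2 ⟨hx1, h2⟩, hx2.trans h3, ?_⟩
      rw [List.dropLast_cons_of_ne_nil hne]
      exact hx3.trans h4
  obtain ⟨s, h1, h2, h3, h4⟩ := main n 0 (by omega)
  have hne : s ≠ [] := by rintro rfl; simp at h1
  obtain ⟨x, hx1, hx2⟩ := ((hU s).and (eventually_limitColour U c 0 s.dropLast)).exists
  refine ⟨x, s, h1, List.pairwise_cons.2 ⟨hx1, h2⟩, ?_⟩
  exact h3.trans (hx2.trans h4).symm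

/-! ### Natural models and type raising -/

theorem natType_succ_iff {X P : M} (hP : IsPowerset P X) (i : ℕ) (a : M) :
    NatType X (i + 1) a ↔ NatType P i a := by
  induction i generalizing a with
  | zero => exact (hP.2 a).symm
  | succ i ih => exact and_congr_right fun _ => forall₂_congr fun b _ => ih b

/-- Raising the types amounts to passing to the power set of the base set. -/
theorem natRealize_raise {X P : M} (hP : IsPowerset P X) {m : ℕ} {Γ : Fin m → ℕ}
    (φ : TSTFormula Γ) (Δ : Fin m → ℕ) (hΔ : ∀ x, Δ x = Γ x + 1) (v : Fin m → M) :
    NatRealize X (φ.raise Δ hΔ) v ↔ NatRealize P φ v := by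
  induction φ with
  | falsum => rfl
  | equal => rfl
  | mem => rfl
  | imp φ ψ ihφ ihψ => exact imp_congr (ihφ _ _ _) (ihψ _ _ _)
  | all i φ ih => exact forall_congr' fun a => imp_congr (natType_succ_iff hP i a) (ih _ _ _)

theorem natModels_plus {X P : M} (hP : IsPowerset P X) (φ : TSTSentence) :
    NatModels X φ.plus ↔ NatModels P φ :=
  natRealize_raise hP φ _ _ _

theorem TSTFormula.TypesLT.mono {n n' : ℕ} (h : n ≤ n') {m : ℕ} {Γ : Fin m → ℕ}
    {φ : TSTFormula Γ} (hφ : φ.TypesLT n) : φ.TypesLT n' := by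
  induction φ with
  | falsum => trivial
  | equal => trivial
  | mem => trivial
  | imp φ ψ ihφ ihψ => exact ⟨ihφ hφ.1, ihψ hφ.2⟩
  | all i φ ih => exact ⟨hφ.1.trans_le h, ih hφ.2⟩

theorem TSTFormula.exists_typesLT {m : ℕ} {Γ : Fin m → ℕ} (φ : TSTFormula Γ) :
    ∃ n, φ.TypesLT n := by
  induction φ with
  | falsum => exact ⟨0, trivial⟩
  | equal => exact ⟨0, trivial⟩
  | mem => exact ⟨0, trivial⟩
  | imp φ ψ ihφ ihψ =>
    obtain ⟨a, ha⟩ := ihφ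
    obtain ⟨b, hb⟩ := ihψ
    exact ⟨max a b, ha.mono (le_max_left a b), hb.mono (le_max_right a b)⟩
  | all i φ ih =>
    obtain ⟨a, ha⟩ := ih
    exact ⟨max (i + 1) a, le_max_left (i + 1) a, ha.mono (le_max_right _ a)⟩

theorem exists_forall_typesLT (S : Finset TSTSentence) : ∃ n, ∀ φ ∈ S, φ.TypesLT (n + 1) := by
  choose n hn using fun φ : TSTSentence => φ.exists_typesLT
  exact ⟨S.sup n, fun φ hφ => (hn φ).mono ((Finset.le_sup hφ).trans (Nat.le_succ _))⟩

/-! ### Ambiguity for finitely many sentences -/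

/-- `A` is the set whose members are the terms of the list `s`, a list of members of the ordinal
`l` in decreasing order. -/
structure Lists (l : M) (s : List M) (A : M) : Prop where
  isSet : IsSet A
  mem_iff : ∀ x, x ∈ₘ A ↔ x ∈ s
  mem : ∀ x ∈ s, x ∈ₘ l
  pairwise : s.Pairwise fun x y => y ∈ₘ x

theorem Lists.isIndex (hM : IsSetTheoryModel M) {l A : M} {s : List M} (h : Lists l s A)
    (hs : s ≠ []) : IsIndex l A :=
  ⟨hM.isFiniteSet_of_list h.isSet h.mem_iff,
    (List.exists_mem_of_ne_nil s hs).imp fun x => (h.mem_iff x).2,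
    fun x hx => h.mem x ((h.mem_iff x).1 hx)⟩

theorem Lists.size_eq (hM : IsSetTheoryModel M) {l A : M} (hl : IsOrdinal l) {s : List M}
    (h : Lists l s A) : size A = s.length := by
  classical
  have hnd : s.Nodup := h.pairwise.imp_of_mem fun {a b} ha _ hab => by
    rintro rfl
    exact hl.not_mem_self hM (h.mem a ha) hab
  have : {x | x ∈ₘ A} = (s.toFinset : Set M) := by ext x; simp [h.mem_iff]
  rw [size, this, Set.encard_coe_eq_coe_finsetCard, List.toFinset_card_of_nodup hnd]

theorem Lists.isTail (hM : IsSetTheoryModel M) {l A B a : M} (hl : IsOrdinal l) {s : List M}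
    (hA : Lists l (s ++ [a]) A) (hB : Lists l s B) : IsTail B A := by
  have hp := List.pairwise_append.1 hA.pairwise
  refine ⟨a, ⟨(hA.mem_iff a).2 (by simp), fun x hx => ?_⟩, hB.isSet, fun x => ?_⟩
  · rcases List.mem_append.1 ((hA.mem_iff x).1 hx) with h | h
    · exact Or.inr (hp.2.2 x h a (by simp))
    · exact Or.inl (by simpa using h)
  · rw [hB.mem_iff, hA.mem_iff]
    constructor
    · refine fun hx => ⟨by simp [hx], ?_⟩
      rintro rfl
      exact hl.not_mem_self hM (hB.mem x hx) (hp.2.2 x hx x (by simp))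
    · rintro ⟨h, hne⟩
      simpa [hne] using h

theorem Lists.exists_prefix (hM : IsSetTheoryModel M) {l A : M} {s t : List M}
    (hA : Lists l (s ++ t) A) : ∃ B, Lists l s B := by
  obtain ⟨B, hB, h⟩ := hM.exists_ofList l s
  exact ⟨B, hB, h, fun x hx => hA.mem x (by simp [hx]), (List.pairwise_append.1 hA.pairwise).1⟩

theorem Lists.isIterTail (hM : IsSetTheoryModel M) {l A : M} (hl : IsOrdinal l) {s t : List M}
    (hA : Lists l (s ++ t) A) {B : M} (hB : Lists l s B) : IsIterTail t.length B A := by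
  induction t generalizing s B with
  | nil =>
    refine hM.extensionality _ _ hB.isSet hA.isSet fun z => ?_
    rw [hB.mem_iff, hA.mem_iff, List.append_nil]
  | cons a t ih =>
    have hA' : Lists l ((s ++ [a]) ++ t) A := by simpa using hA
    obtain ⟨C, hC⟩ := hA'.exists_prefix hM
    exact ⟨C, ih hA' hC, hC.isTail hM hl hB⟩

/-- Given a tangled web and finitely many sentences, some natural model satisfies the instances of
ambiguity for these sentences. -/
theorem IsTangledWeb.exists_ambiguous (hM : IsSetTheoryModel M) {l : M} {τ : M → Set M}
    (hτ : IsTangledWeb l τ) (S : Finset TSTSentence) :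
    ∃ A, IsIndex l A ∧ ∃ X ∈ τ A, ∀ φ ∈ S, (NatModels X φ ↔ NatModels X φ.plus) := by
  classical
  obtain ⟨n, hn⟩ := exists_forall_typesLT S
  have ho := hτ.isLimitOrdinal.1
  obtain ⟨f, hf, hfl⟩ := hτ.isLimitOrdinal.exists_filter hM
  -- The colour of a sequence is the theory, restricted to `S`, of the natural models belonging to
  -- the sets `A` of which it is the initial segment.
  let c : List {x // x ∈ₘ l} → Set S := fun t => {φ | ∃ (s : List M) (A X : M), s ≠ [] ∧
    Lists l (s ++ t.map Subtype.val) A ∧ X ∈ τ A ∧ NatModels X φ.1}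
  have hc : ∀ (t : List {x // x ∈ₘ l}) (s : List M) (A X : M), t.length = n + 1 → s ≠ [] →
      Lists l (s ++ t.map Subtype.val) A → X ∈ τ A → ∀ φ : S, φ ∈ c t ↔ NatModels X φ.1 := by
    intro t s A X ht hs hA hX φ
    refine ⟨?_, fun h => ⟨s, A, X, hs, hA, hX, h⟩⟩
    rintro ⟨s', A', X', hs', hA', hX', h⟩
    have aux : ∀ {s : List M} {A : M}, s ≠ [] → Lists l (s ++ t.map Subtype.val) A →
        IsIndex l A ∧ ((n + 1 : ℕ) : ℕ∞) < size A ∧ ∃ B, IsIterTail (n + 1) B A ∧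
          ∀ x, (x ∈ₘ A ∧ ¬ x ∈ₘ B) ↔ x ∈ t.map Subtype.val := by
      intro s A hs hA
      refine ⟨hA.isIndex hM (by simp [hs]), ?_, ?_⟩
      · rw [hA.size_eq hM ho, List.length_append, List.length_map, ht]
        have := List.length_pos_iff.2 hs
        exact_mod_cast (by omega : n + 1 < s.length + (n + 1))
      · obtain ⟨B, hB⟩ := hA.exists_prefix hM
        refine ⟨B, by simpa [ht] using hA.isIterTail hM ho hB, fun x => ?_⟩
        rw [hA.mem_iff, hB.mem_iff, List.mem_append]
        constructor
        · rintro ⟨h1 | h1, h2⟩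
          · exact absurd h1 h2
          · exact h1
        · refine fun hx => ⟨Or.inr hx, fun hx' => ?_⟩
          exact ho.not_mem_self hM (hB.mem x hx')
            ((List.pairwise_append.1 hA.pairwise).2.2 x hx' x hx)
    obtain ⟨h1, h2, B, h3, h4⟩ := aux hs hA
    obtain ⟨h1', h2', B', h3', h4'⟩ := aux hs' hA'
    have := hτ.elementarity (n + 1) A' B' A B h1' h1 h2' h2 h3' h3
      (fun x => (h4' x).trans (h4 x).symm) X' hX' X hX
    have h5 : φ.1 ∈ natTheory (n + 1) X' := ⟨hn φ.1 φ.2, h⟩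
    rw [this] at h5
    exact h5.2
  obtain ⟨x, s, hs, hp, hxs⟩ := exists_list_colour_tail_eq f
    (fun x y : {x // x ∈ₘ l} => y.1 ∈ₘ x.1) hfl c n
  -- One further term makes room for the strict inequality of elementarity, for `A` and its tail.
  obtain ⟨y, hy⟩ := ((Filter.eventually_all_finite (x :: s).finite_toSet
    (p := fun a (y : {x // x ∈ₘ l}) => a.1 ∈ₘ y.1)).2 fun a _ => hfl a).exists
  obtain ⟨A, hA, hAm⟩ := hM.exists_ofList l ((y :: x :: s).map Subtype.val)
  have hLA : Lists l ((y :: x :: s).map Subtype.val) A := by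
    refine ⟨hA, hAm, fun z hz => ?_, List.pairwise_map.2 (List.pairwise_cons.2 ⟨hy, hp⟩)⟩
    obtain ⟨w, -, rfl⟩ := List.mem_map.1 hz
    exact w.2
  have hne : s ≠ [] := by rintro rfl; simp at hs
  have hLA' : Lists l ((y :: x :: s.dropLast).map Subtype.val ++ [(s.getLast hne).1]) A := by
    have : (y :: x :: s).map Subtype.val =
        (y :: x :: s.dropLast).map Subtype.val ++ [(s.getLast hne).1] := by
      conv_lhs => rw [← List.dropLast_append_getLast hne]
      simp
    rwa [← this]
  obtain ⟨B, hB⟩ := hLA'.exists_prefix hM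
  have hiA : IsIndex l A := hLA.isIndex hM (by simp)
  have hτAB : twoPow (τ A) = τ B := by
    refine hτ.naturality A B hiA ?_ (hLA'.isTail hM ho hB)
    rw [hLA.size_eq hM ho, List.length_map, List.length_cons, List.length_cons]
    exact_mod_cast Nat.le_add_left 2 s.length
  obtain ⟨X, hX, hXA⟩ := hτ.isCardinal A hiA
  have hXA' : X ∈ τ A := hXA ▸ hM.mem_card_self hX
  obtain ⟨P, hP⟩ := hM.powerset X
  have hPB : P ∈ τ B := hτAB ▸ ⟨X, hXA', P, hP, hM.mem_card_self hP.1⟩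
  refine ⟨A, hiA, X, hXA', fun φ hφ => ?_⟩
  rw [natModels_plus hP, ← hc s [y.1, x.1] A X hs (by simp) (by simpa using hLA) hXA' ⟨φ, hφ⟩,
    ← hc (x :: s.dropLast) [y.1] B P (by simp [hs]) (by simp) (by simpa using hB) hPB ⟨φ, hφ⟩,
    hxs]

/-! ### Operations on typed formulas -/

namespace TSTFormula

/-- Rename the variables of a formula along a type preserving map. -/
def rename : {m : ℕ} → {Γ : Fin m → ℕ} → TSTFormula Γ → {k : ℕ} → (Δ : Fin k → ℕ) →
    (ρ : Fin m → Fin k) → (∀ x, Δ (ρ x) = Γ x) → TSTFormula Δ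
  | _, _, .falsum, _, _, _, _ => .falsum
  | _, _, .equal x y h, _, _, ρ, hρ => .equal (ρ x) (ρ y) (by rw [hρ, hρ, h])
  | _, _, .mem x y h, _, _, ρ, hρ => .mem (ρ x) (ρ y) (by rw [hρ, hρ, h])
  | _, _, .imp φ ψ, _, Δ, ρ, hρ => .imp (φ.rename Δ ρ hρ) (ψ.rename Δ ρ hρ)
  | m, _, .all i φ, k, Δ, ρ, hρ => .all i (φ.rename (Fin.snoc (α := fun _ => ℕ) Δ i)
      (Fin.snoc (α := fun _ => Fin (k + 1)) (fun x => (ρ x).castSucc) (Fin.last k)) (by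
        intro x
        refine Fin.lastCases ?_ (fun y => ?_) x
        · simp
        · simp [hρ]))

/-- The negation of a formula. -/
def not {m : ℕ} {Γ : Fin m → ℕ} (φ : TSTFormula Γ) : TSTFormula Γ := φ.imp .falsum

/-- Existential quantification over the objects of type `i`. -/
def ex {m : ℕ} {Γ : Fin m → ℕ} (i : ℕ) (φ : TSTFormula (Fin.snoc (α := fun _ => ℕ) Γ i)) :
    TSTFormula Γ := (TSTFormula.all i φ.not).not

/-- The conjunction of two formulas. -/
def and {m : ℕ} {Γ : Fin m → ℕ} (φ ψ : TSTFormula Γ) : TSTFormula Γ := (φ.imp ψ.not).not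

/-- The conjunction of a list of formulas. -/
def conj {m : ℕ} {Γ : Fin m → ℕ} : List (TSTFormula Γ) → TSTFormula Γ
  | [] => .not .falsum
  | φ :: s => φ.and (conj s)

end TSTFormula

theorem natRealize_rename {X : M} {m : ℕ} {Γ : Fin m → ℕ} (φ : TSTFormula Γ) {k : ℕ}
    (Δ : Fin k → ℕ) (ρ : Fin m → Fin k) (hρ : ∀ x, Δ (ρ x) = Γ x) (v : Fin k → M) :
    NatRealize X (φ.rename Δ ρ hρ) v ↔ NatRealize X φ (fun x => v (ρ x)) := by
  induction φ generalizing k with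
  | falsum => rfl
  | equal => rfl
  | mem => rfl
  | imp φ ψ ihφ ihψ => exact imp_congr (ihφ _ _ _ _) (ihψ _ _ _ _)
  | all i φ ih =>
    refine forall_congr' fun a => imp_congr_right fun _ => (ih _ _ _ _).trans (iff_of_eq ?_)
    congr 1
    funext x
    refine Fin.lastCases ?_ (fun y => ?_) x <;> simp

theorem natRealize_not {X : M} {m : ℕ} {Γ : Fin m → ℕ} (φ : TSTFormula Γ) (v : Fin m → M) :
    NatRealize X φ.not v ↔ ¬ NatRealize X φ v := Iff.rfl

theorem natRealize_ex {X : M} {m : ℕ} {Γ : Fin m → ℕ} (i : ℕ)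
    (φ : TSTFormula (Fin.snoc (α := fun _ => ℕ) Γ i)) (v : Fin m → M) :
    NatRealize X (φ.ex i) v ↔
      ∃ a, NatType X i a ∧ NatRealize X φ (Fin.snoc (α := fun _ => M) v a) := by
  refine Iff.trans ?_ (not_forall_not (p := fun a => NatType X i a ∧ NatRealize X φ
    (Fin.snoc (α := fun _ => M) v a)))
  exact not_congr (forall_congr' fun a => not_and.symm)

theorem natRealize_and {X : M} {m : ℕ} {Γ : Fin m → ℕ} (φ ψ : TSTFormula Γ) (v : Fin m → M) :
    NatRealize X (φ.and ψ) v ↔ NatRealize X φ v ∧ NatRealize X ψ v :=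
  Classical.not_imp.trans (and_congr_right fun _ => not_not)

theorem natRealize_conj {X : M} {m : ℕ} {Γ : Fin m → ℕ} (s : List (TSTFormula Γ))
    (v : Fin m → M) :
    NatRealize X (TSTFormula.conj s) v ↔ ∀ φ ∈ s, NatRealize X φ v := by
  induction s with
  | nil => exact ⟨fun _ φ hφ => absurd hφ List.not_mem_nil, fun _ h => h⟩
  | cons φ s ih => simp [TSTFormula.conj, natRealize_and, ih]

/-- The syntax tree of a typed formula, without the conditions on types. -/
inductive RawFormula : Type
  | falsum : RawFormula
  | equal (x y : ℕ) : RawFormula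
  | mem (x y : ℕ) : RawFormula
  | imp (φ ψ : RawFormula) : RawFormula
  | all (i : ℕ) (φ : RawFormula) : RawFormula
  deriving Encodable

/-- The syntax tree of a typed formula. -/
def TSTFormula.raw : {m : ℕ} → {Γ : Fin m → ℕ} → TSTFormula Γ → RawFormula
  | _, _, .falsum => .falsum
  | _, _, .equal x y _ => .equal x y
  | _, _, .mem x y _ => .mem x y
  | _, _, .imp φ ψ => .imp φ.raw ψ.raw
  | _, _, .all i φ => .all i φ.raw

theorem TSTFormula.raw_injective {m : ℕ} {Γ : Fin m → ℕ} :
    Function.Injective (TSTFormula.raw : TSTFormula Γ → RawFormula) := by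
  intro φ ψ h
  induction φ with
  | falsum => cases ψ <;> simp_all [TSTFormula.raw]
  | equal x y hxy => cases ψ <;> simp_all [TSTFormula.raw, Fin.ext_iff]
  | mem x y hxy => cases ψ <;> simp_all [TSTFormula.raw, Fin.ext_iff]
  | imp φ₁ φ₂ ih₁ ih₂ =>
    cases ψ with
    | imp ψ₁ ψ₂ =>
      simp only [TSTFormula.raw, RawFormula.imp.injEq] at h
      rw [ih₁ h.1, ih₂ h.2]
    | _ => simp_all [TSTFormula.raw]
  | all i φ ih =>
    cases ψ with
    | all j ψ =>
      simp only [TSTFormula.raw, RawFormula.all.injEq] at h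
      obtain ⟨rfl, h⟩ := h
      rw [ih h]
    | _ => simp_all [TSTFormula.raw]

instance {m : ℕ} {Γ : Fin m → ℕ} : Countable (TSTFormula Γ) :=
  TSTFormula.raw_injective.countable

/-! ### Countable saturation -/

/-- Ultraproducts over `ℕ` are countably saturated: countably many conditions on an element are
realized simultaneously if finitely many of them always are. The `n`-th coordinate meets as many
of the first `n` conditions as possible. -/
theorem exists_forall_eventually {ι D : Type*} [Countable ι] (f : Filter ℕ) [f.NeBot]
    (hf : f ≤ Filter.atTop) (P : ι → ℕ → D → Prop)
    (h : ∀ F : Finset ι, ∀ᶠ n in f, ∃ y, ∀ j ∈ F, P j n y) :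
    ∃ b : ℕ → D, ∀ j, ∀ᶠ n in f, P j n (b n) := by
  classical
  obtain ⟨e, he⟩ := exists_injective_nat ι
  obtain ⟨n₀, y₀, -⟩ := (h ∅).exists
  let Q : ℕ → ℕ → Prop := fun n k => ∃ y, ∀ j, e j < k → P j n y
  have hQ0 : ∀ n, Q n 0 := fun n => ⟨y₀, fun j hj => absurd hj (Nat.not_lt_zero _)⟩
  have hQ : ∀ k, ∀ᶠ n in f, Q n k := by
    intro k
    have hfin : {j | e j < k}.Finite := (Set.finite_Iio k).preimage he.injOn
    filter_upwards [h hfin.toFinset] with n ⟨y, hy⟩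
    exact ⟨y, fun j hj => hy j (by simpa using hj)⟩
  choose b hb using fun n => Nat.findGreatest_spec (Nat.zero_le n) (hQ0 n)
  refine ⟨b, fun j => ?_⟩
  filter_upwards [hQ (e j + 1), hf (Filter.eventually_ge_atTop (e j + 1))] with n hn hle
  exact hb n j (Nat.lt_of_lt_of_le (Nat.lt_succ_self _) (Nat.le_findGreatest hle hn))

/-! ### Partial elementary maps between ultraproducts of natural models -/

/-- Truth of a formula in the ultraproduct of the natural models with base sets `X n`. The elements
of the ultraproduct are represented by sequences of objects. -/
def UltraRealize (U : Ultrafilter ℕ) (X : ℕ → M) {m : ℕ} {Γ : Fin m → ℕ} (φ : TSTFormula Γ)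
    (v : Fin m → ℕ → M) : Prop :=
  ∀ᶠ n in U, NatRealize (X n) φ fun x => v x n

/-- `a` represents an object of type `i` of the ultraproduct. -/
def UltraType (U : Ultrafilter ℕ) (X : ℕ → M) (i : ℕ) (a : ℕ → M) : Prop :=
  ∀ᶠ n in U, NatType (X n) i (a n)

theorem ultraRealize_imp {U : Ultrafilter ℕ} {X : ℕ → M} {m : ℕ} {Γ : Fin m → ℕ}
    (φ ψ : TSTFormula Γ) (v : Fin m → ℕ → M) : UltraRealize U X (φ.imp ψ) v ↔
      (UltraRealize U X φ v → UltraRealize U X ψ v) :=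
  Ultrafilter.eventually_imp

theorem ultraRealize_not {U : Ultrafilter ℕ} {X : ℕ → M} {m : ℕ} {Γ : Fin m → ℕ}
    (φ : TSTFormula Γ) (v : Fin m → ℕ → M) : UltraRealize U X φ.not v ↔ ¬ UltraRealize U X φ v :=
  Ultrafilter.eventually_not

theorem snoc_apply {D : Type*} {m : ℕ} (v : Fin m → ℕ → D) (a : ℕ → D) (n : ℕ) :
    (fun x => Fin.snoc (α := fun _ => ℕ → D) v a x n) =
      Fin.snoc (α := fun _ => D) (fun x => v x n) (a n) := by
  funext x
  refine Fin.lastCases ?_ (fun y => ?_) x <;> simp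

theorem ultraRealize_ex {U : Ultrafilter ℕ} {X : ℕ → M} {m : ℕ} {Γ : Fin m → ℕ} (i : ℕ)
    (φ : TSTFormula (Fin.snoc (α := fun _ => ℕ) Γ i)) (v : Fin m → ℕ → M) :
    UltraRealize U X (φ.ex i) v ↔
      ∃ a, UltraType U X i a ∧ UltraRealize U X φ (Fin.snoc (α := fun _ => ℕ → M) v a) := by
  simp only [UltraRealize, UltraType, natRealize_ex, snoc_apply]
  constructor
  · intro h
    obtain ⟨n₀, a₀, -⟩ := h.exists
    have : ∀ n, ∃ a, (∃ a, NatType (X n) i a ∧ NatRealize (X n) φ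
        (Fin.snoc (α := fun _ => M) (fun x => v x n) a)) → NatType (X n) i a ∧
          NatRealize (X n) φ (Fin.snoc (α := fun _ => M) (fun x => v x n) a) := fun n => by
      by_cases hn : ∃ a, NatType (X n) i a ∧ NatRealize (X n) φ
        (Fin.snoc (α := fun _ => M) (fun x => v x n) a)
      · exact hn.imp fun a ha _ => ha
      · exact ⟨a₀, fun h => absurd h hn⟩
    choose a ha using this
    have h' := h.mono fun n hn => ha n hn
    exact ⟨a, h'.mono fun n hn => hn.1, h'.mono fun n hn => hn.2⟩
  · rintro ⟨a, h1, h2⟩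
    filter_upwards [h1, h2] with n hn1 hn2
    exact ⟨a n, hn1, hn2⟩

/-- A set of triples `(i, a, b)`, with `a` and `b` objects of type `i` of the ultraproducts of the
natural models with base sets `X n` and `Y n`, that is the graph of a partial elementary map from
the first ultraproduct to the second one. -/
structure IsPartialElementary (U : Ultrafilter ℕ) (X Y : ℕ → M)
    (R : Set (ℕ × (ℕ → M) × (ℕ → M))) : Prop where
  left : ∀ r ∈ R, UltraType U X r.1 r.2.1
  right : ∀ r ∈ R, UltraType U Y r.1 r.2.2
  realize_iff : ∀ {m : ℕ} {Γ : Fin m → ℕ} (φ : TSTFormula Γ) (v w : Fin m → ℕ → M),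
    (∀ x, (Γ x, v x, w x) ∈ R) → (UltraRealize U X φ v ↔ UltraRealize U Y φ w)

/-- Finitely many conditions `φ_j(y, c⃗) ↔ ε_j` on an object `y` of type `i`, with parameters taken
from the domain of a partial elementary map, are expressed by a single formula; here `s` says which
variables of `φ_j` stand for `y`. -/
theorem exists_formula_of_finset {R : Set (ℕ × (ℕ → M) × (ℕ → M))} (i : ℕ) {ι : Type*}
    (F : Finset ι) (m : ι → ℕ) (Γ : ∀ j, Fin (m j) → ℕ) (φ : ∀ j, TSTFormula (Γ j))
    (s : ∀ j, Fin (m j) → Option R) (hs : ∀ j x, Γ j x = (s j x).elim i fun r => r.1.1)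
    (ε : ι → Prop) :
    ∃ (k : ℕ) (p : Fin k → R) (θ : TSTFormula fun x => (p x).1.1), ∀ (X : M) (g : R → M),
      NatRealize X θ (g ∘ p) ↔ ∃ y, NatType X i y ∧
        ∀ j ∈ F, (NatRealize X (φ j) (fun x => (s j x).elim y g) ↔ ε j) := by
  classical
  -- the parameters that occur
  let S : Finset R := F.biUnion fun j => Finset.univ.biUnion fun x => (s j x).toFinset
  have hS : ∀ j ∈ F, ∀ x r, s j x = some r → r ∈ S := by
    intro j hj x r h
    simp only [S, Finset.mem_biUnion]
    exact ⟨j, hj, x, Finset.mem_univ _, by simp [h]⟩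
  let e := S.equivFin
  let p : Fin S.card → R := fun x => (e.symm x).1
  let Δ : Fin S.card → ℕ := fun x => (p x).1.1
  have hρ : ∀ j ∈ F, ∃ ρ : Fin (m j) → Fin (S.card + 1),
      (∀ x, Fin.snoc (α := fun _ => ℕ) Δ i (ρ x) = Γ j x) ∧
      ∀ (g : R → M) (y : M) x,
        Fin.snoc (α := fun _ => M) (g ∘ p) y (ρ x) = (s j x).elim y g := by
    intro j hj
    have : ∀ x, ∃ z : Fin (S.card + 1), Fin.snoc (α := fun _ => ℕ) Δ i z = Γ j x ∧
        ∀ (g : R → M) (y : M), Fin.snoc (α := fun _ => M) (g ∘ p) y z = (s j x).elim y g := by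
      intro x
      rw [hs]
      cases h : s j x with
      | none => exact ⟨Fin.last _, by simp⟩
      | some r =>
        refine ⟨(e ⟨r, hS j hj x r h⟩).castSucc, ?_, fun g y => ?_⟩
        · simp [Δ, p]
        · simp [p]
    choose ρ h1 h2 using this
    exact ⟨ρ, h1, fun g y x => h2 x g y⟩
  choose ρ hρ1 hρ2 using hρ
  let χ : F → TSTFormula (Fin.snoc (α := fun _ => ℕ) Δ i) := fun j =>
    if ε j.1 then (φ j.1).rename _ (ρ j.1 j.2) (hρ1 j.1 j.2)
    else ((φ j.1).rename _ (ρ j.1 j.2) (hρ1 j.1 j.2)).not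
  have hχ : ∀ (X : M) (g : R → M) (y : M) (j : F),
      NatRealize X (χ j) (Fin.snoc (α := fun _ => M) (g ∘ p) y) ↔
        (NatRealize X (φ j.1) (fun x => (s j.1 x).elim y g) ↔ ε j.1) := by
    intro X g y j
    by_cases h : ε j.1
    · simp only [χ, h, if_true, natRealize_rename, hρ2, iff_true]
    · simp only [χ, h, if_false, natRealize_not, natRealize_rename, hρ2, iff_false]
  refine ⟨S.card, p, (TSTFormula.conj (F.attach.toList.map χ)).ex i, fun X g => ?_⟩
  rw [natRealize_ex]
  refine exists_congr fun y => and_congr_right fun _ => ?_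
  rw [natRealize_conj]
  simp only [List.mem_map, Finset.mem_toList, forall_exists_index, and_imp,
    forall_apply_eq_imp_iff₂]
  exact ⟨fun h j hj => (hχ X g y ⟨j, hj⟩).1 (h ⟨j, hj⟩ (Finset.mem_attach _ _)),
    fun h j _ => (hχ X g y j).2 (h j.1 j.2)⟩

/-- The forth step: every object of the first ultraproduct can be added to the domain of a
countable partial elementary map. -/
theorem IsPartialElementary.forth {U : Ultrafilter ℕ} (hU : (U : Filter ℕ) ≤ Filter.atTop)
    {X Y : ℕ → M} {R : Set (ℕ × (ℕ → M) × (ℕ → M))} (hR : IsPartialElementary U X Y R)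
    (hc : R.Countable) {i : ℕ} {a : ℕ → M} (ha : UltraType U X i a) :
    ∃ b, IsPartialElementary U X Y (insert (i, a, b) R) := by
  classical
  have : Countable R := hc.to_subtype
  -- The conditions on `b` are indexed by the formulas, each of whose variables stands for `b` or
  -- for a member of the range of the map.
  let ι := Σ (m : ℕ) (Γ : Fin m → ℕ) (_ : TSTFormula Γ),
    {s : Fin m → Option R // ∀ x, Γ x = (s x).elim i fun r => r.1.1}
  let ε : ι → Prop := fun j =>
    UltraRealize U X j.2.2.1 fun x => (j.2.2.2.1 x).elim a fun r => r.1.2.1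
  obtain ⟨b, hb⟩ := exists_forall_eventually (ι := ι) (U : Filter ℕ) hU
    (fun j n y => NatType (Y n) i y ∧
      (NatRealize (Y n) j.2.2.1 (fun x => (j.2.2.2.1 x).elim y fun r => r.1.2.2 n) ↔ ε j)) (by
    intro F
    obtain ⟨k, p, θ, hθ⟩ := exists_formula_of_finset i F (fun j => j.1) (fun j => j.2.1)
      (fun j => j.2.2.1) (fun j => j.2.2.2.1) (fun j => j.2.2.2.2) ε
    have h1 : UltraRealize U X θ fun x => (p x).1.2.1 := by
      have h2 : ∀ᶠ n in (U : Filter ℕ), ∀ j ∈ F,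
          (NatRealize (X n) j.2.2.1 (fun x => (j.2.2.2.1 x).elim (a n) fun r => r.1.2.1 n) ↔
            ε j) := by
        refine (Filter.eventually_all_finset F).2 fun j _ => ?_
        have h3 : ∀ n, (fun x => (j.2.2.2.1 x).elim (a n) fun r => r.1.2.1 n) =
            fun x => (j.2.2.2.1 x).elim a (fun r => r.1.2.1) n := by
          intro n
          funext x
          cases j.2.2.2.1 x <;> rfl
        simp only [h3]
        by_cases h : ε j
        · simp only [h, iff_true]
          exact h
        · simp only [h, iff_false]
          exact Ultrafilter.eventually_not.2 h
      filter_upwards [h2, ha] with n hn hn'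
      exact (hθ (X n) fun r => r.1.2.1 n).2 ⟨a n, hn', hn⟩
    have h2 := (hR.realize_iff θ (fun x => (p x).1.2.1) (fun x => (p x).1.2.2)
      fun x => (p x).2).1 h1
    filter_upwards [h2] with n hn
    obtain ⟨y, hy, h⟩ := (hθ (Y n) fun r => r.1.2.2 n).1 hn
    exact ⟨y, fun j hj => ⟨hy, h j hj⟩⟩)
  have hbt : UltraType U Y i b := (hb ⟨0, Fin.elim0, .falsum, Fin.elim0, fun x => x.elim0⟩).mono
    fun n hn => hn.1
  refine ⟨b, ?_, ?_, ?_⟩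
  · rintro r (rfl | hr)
    exacts [ha, hR.left r hr]
  · rintro r (rfl | hr)
    exacts [hbt, hR.right r hr]
  · intro m Γ φ v w hvw
    have : ∀ x, ∃ o : Option R, Γ x = (o.elim i fun r => r.1.1) ∧
        v x = (o.elim a fun r => r.1.2.1) ∧ w x = (o.elim b fun r => r.1.2.2) := by
      intro x
      rcases hvw x with h | h
      · simp only [Prod.mk.injEq] at h
        exact ⟨none, h⟩
      · exact ⟨some ⟨_, h⟩, rfl, rfl, rfl⟩
    choose s hs1 hs2 hs3 using this
    obtain rfl : v = _ := funext hs2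
    obtain rfl : w = _ := funext hs3
    have h1 := hb ⟨m, Γ, φ, s, hs1⟩
    have h3 : ∀ n, (fun x => (s x).elim (b n) fun r => r.1.2.2 n) =
        fun x => (s x).elim b (fun r => r.1.2.2) n := by
      intro n
      funext x
      cases s x <;> rfl
    simp only [h3] at h1
    constructor
    · intro h
      exact h1.mono fun n hn => hn.2.2 h
    · intro h
      obtain ⟨n, hn1, hn2⟩ := (h1.and h).exists
      exact hn1.2.1 hn2

/-- The inverse of a partial elementary map. -/
theorem IsPartialElementary.symm {U : Ultrafilter ℕ} {X Y : ℕ → M}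
    {R : Set (ℕ × (ℕ → M) × (ℕ → M))} (hR : IsPartialElementary U X Y R) :
    IsPartialElementary U Y X ((fun r => (r.1, r.2.2, r.2.1)) ⁻¹' R) :=
  ⟨fun _ hr => hR.right _ hr, fun _ hr => hR.left _ hr,
    fun φ v w h => (hR.realize_iff φ w v h).symm⟩

/-- The back step: every object of the second ultraproduct can be added to the range of a
countable partial elementary map. -/
theorem IsPartialElementary.back {U : Ultrafilter ℕ} (hU : (U : Filter ℕ) ≤ Filter.atTop)
    {X Y : ℕ → M} {R : Set (ℕ × (ℕ → M) × (ℕ → M))} (hR : IsPartialElementary U X Y R)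
    (hc : R.Countable) {i : ℕ} {b : ℕ → M} (hb : UltraType U Y i b) :
    ∃ a, IsPartialElementary U X Y (insert (i, a, b) R) := by
  have hinj : Function.Injective
      (fun r : ℕ × (ℕ → M) × (ℕ → M) => (r.1, r.2.2, r.2.1)) := by
    rintro ⟨i, a, b⟩ ⟨j, c, d⟩ h
    simp only [Prod.mk.injEq] at h ⊢
    tauto
  obtain ⟨a, ha⟩ := hR.symm.forth hU (hc.preimage hinj) hb
  refine ⟨a, ?_⟩
  convert ha.symm using 1
  ext ⟨j, c, d⟩
  simp only [Set.mem_insert_iff, Set.mem_preimage, Prod.mk.injEq]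
  tauto

/-! ### Threads -/

theorem ultraType_succ_iff {U : Ultrafilter ℕ} {X Y : ℕ → M} (hXY : ∀ n, IsPowerset (Y n) (X n))
    (i : ℕ) (a : ℕ → M) : UltraType U X (i + 1) a ↔ UltraType U Y i a :=
  Filter.eventually_congr (Filter.Eventually.of_forall fun n => natType_succ_iff (hXY n) i (a n))

theorem IsPartialElementary.mono {U : Ultrafilter ℕ} {X Y : ℕ → M}
    {R R' : Set (ℕ × (ℕ → M) × (ℕ → M))} (hR : IsPartialElementary U X Y R) (h : R' ⊆ R) :
    IsPartialElementary U X Y R' :=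
  ⟨fun r hr => hR.left r (h hr), fun r hr => hR.right r (h hr),
    fun φ v w hvw => hR.realize_iff φ v w fun x => h (hvw x)⟩

theorem isPartialElementary_iUnion {U : Ultrafilter ℕ} {X Y : ℕ → M}
    {R : ℕ → Set (ℕ × (ℕ → M) × (ℕ → M))} (hmono : Monotone R)
    (hR : ∀ t, IsPartialElementary U X Y (R t)) : IsPartialElementary U X Y (⋃ t, R t) := by
  refine ⟨fun r hr => ?_, fun r hr => ?_, fun φ v w hvw => ?_⟩
  · obtain ⟨t, ht⟩ := Set.mem_iUnion.1 hr
    exact (hR t).left r ht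
  · obtain ⟨t, ht⟩ := Set.mem_iUnion.1 hr
    exact (hR t).right r ht
  · choose t ht using fun x => Set.mem_iUnion.1 (hvw x)
    exact (hR (Finset.univ.sup t)).realize_iff φ v w fun x =>
      hmono (Finset.le_sup (Finset.mem_univ x)) (ht x)

/-- A thread is a sequence `d` with `d i` an object of type `i`. Its graph is the partial map which
sends each `d i` to `d (i + 1)`. -/
def threadGraph (d : ℕ → ℕ → M) : Set (ℕ × (ℕ → M) × (ℕ → M)) :=
  Set.range fun i => (i, d i, d (i + 1))

/-- Every object of type `0` begins a thread whose graph can be added to a given countable partial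
elementary map. -/
theorem IsPartialElementary.exists_thread_zero {U : Ultrafilter ℕ}
    (hU : (U : Filter ℕ) ≤ Filter.atTop) {X Y : ℕ → M} (hXY : ∀ n, IsPowerset (Y n) (X n))
    {R : Set (ℕ × (ℕ → M) × (ℕ → M))} (hR : IsPartialElementary U X Y R) (hc : R.Countable)
    {a : ℕ → M} (ha : UltraType U X 0 a) :
    ∃ d : ℕ → ℕ → M, d 0 = a ∧ IsPartialElementary U X Y (R ∪ threadGraph d) := by
  let S : ℕ → Type _ := fun i => {p : (ℕ → M) × Set (ℕ × (ℕ → M) × (ℕ → M)) //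
    UltraType U X i p.1 ∧ IsPartialElementary U X Y p.2 ∧ p.2.Countable}
  have step : ∀ i (p : S i), ∃ q : S (i + 1), q.1.2 = insert (i, p.1.1, q.1.1) p.1.2 := by
    rintro i ⟨⟨b, T⟩, hb, hT, hTc⟩
    obtain ⟨b', hb'⟩ := hT.forth hU hTc hb
    exact ⟨⟨⟨b', insert (i, b, b') T⟩, (ultraType_succ_iff hXY i b').2
      (hb'.right _ (Set.mem_insert _ _)), hb', hTc.insert _⟩, rfl⟩
  choose g hg using step
  let p : ∀ i, S i := fun i => Nat.rec ⟨(a, R), ha, hR, hc⟩ g i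
  have hp : ∀ i, (p (i + 1)).1.2 = insert (i, (p i).1.1, (p (i + 1)).1.1) (p i).1.2 :=
    fun i => hg i (p i)
  refine ⟨fun i => (p i).1.1, rfl, (isPartialElementary_iUnion (R := fun i => (p i).1.2)
    (monotone_nat_of_le_succ fun i => ?_) fun i => (p i).2.2.1).mono ?_⟩
  · rw [hp]
    exact Set.subset_insert _ _
  · rintro r (hr | ⟨i, rfl⟩)
    · exact Set.mem_iUnion.2 ⟨0, hr⟩
    · refine Set.mem_iUnion.2 ⟨i + 1, ?_⟩
      rw [hp]
      exact Set.mem_insert _ _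

/-- Every object of every type belongs to a thread whose graph can be added to a given countable
partial elementary map: the thread is continued downwards by the back step and upwards by the
forth step. -/
theorem IsPartialElementary.exists_thread {U : Ultrafilter ℕ}
    (hU : (U : Filter ℕ) ≤ Filter.atTop) {X Y : ℕ → M} (hXY : ∀ n, IsPowerset (Y n) (X n))
    {R : Set (ℕ × (ℕ → M) × (ℕ → M))} (hR : IsPartialElementary U X Y R) (hc : R.Countable)
    {i : ℕ} {a : ℕ → M} (ha : UltraType U X i a) :
    ∃ d : ℕ → ℕ → M, d i =ᶠ[U] a ∧ IsPartialElementary U X Y (R ∪ threadGraph d) := by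
  induction i generalizing R a with
  | zero =>
    obtain ⟨d, rfl, hd⟩ := hR.exists_thread_zero hU hXY hc ha
    exact ⟨d, Filter.EventuallyEq.rfl, hd⟩
  | succ i ih =>
    obtain ⟨b, hb⟩ := hR.back hU hc ((ultraType_succ_iff hXY i a).1 ha)
    obtain ⟨d, hd, hd'⟩ := ih hb (hc.insert _) (hb.left _ (Set.mem_insert _ _))
    refine ⟨d, ?_, hd'.mono (Set.union_subset_union_left _ (Set.subset_insert _ _))⟩
    -- `d i` and `b` represent the same object, which is sent to `d (i + 1)` and to `a`.
    refine (hd'.realize_iff (Γ := fun _ : Fin 2 => i) (.equal 0 1 rfl) ![d i, b]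
      ![d (i + 1), a] fun x => ?_).1 hd
    fin_cases x
    · exact Or.inr ⟨i, rfl⟩
    · exact Or.inl (Set.mem_insert _ _)

/-- Recursive choice of a sequence, where `P t` depends only on the terms before the `t`-th one. -/
theorem exists_seq_of_forall_exists_update {α : Type*} [Nonempty α] (P : ℕ → (ℕ → α) → Prop)
    (hP : ∀ t c c', (∀ s < t, c s = c' s) → P t c → P t c') (h0 : ∀ c, P 0 c)
    (h : ∀ t c, P t c → ∃ d, P (t + 1) (Function.update c t d)) : ∃ c, ∀ t, P t c := by
  have h' : ∀ t c, ∃ d, P t c → P (t + 1) (Function.update c t d) := fun t c => by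
    by_cases hc : P t c
    · exact (h t c hc).imp fun d hd _ => hd
    · exact ⟨Classical.arbitrary α, fun hc' => absurd hc' hc⟩
  choose F hF using h'
  let C : ℕ → ℕ → α := fun t => Nat.rec (fun _ => Classical.arbitrary α)
    (fun t c => Function.update c t (F t c)) t
  have hC : ∀ t, C (t + 1) = Function.update (C t) t (F t (C t)) := fun t => rfl
  have hPC : ∀ t, P t (C t) := fun t => by
    induction t with
    | zero => exact h0 _
    | succ t ih => rw [hC]; exact hF t _ ih
  have hstable : ∀ t, ∀ s < t, C t s = C (s + 1) s := fun t => by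
    induction t with
    | zero => exact fun s hs => absurd hs (Nat.not_lt_zero s)
    | succ t ih =>
      intro s hs
      rcases Nat.lt_succ_iff_lt_or_eq.1 hs with hs | rfl
      · rw [hC, Function.update_of_ne hs.ne, ih s hs]
      · rfl
  exact ⟨fun s => C (s + 1) s, fun t => hP t (C t) _ (hstable t) (hPC t)⟩

theorem UltraRealize.congr_snoc {U : Ultrafilter ℕ} {X : ℕ → M} {m : ℕ} {Γ : Fin m → ℕ} {i : ℕ}
    {φ : TSTFormula (Fin.snoc (α := fun _ => ℕ) Γ i)} {v : Fin m → ℕ → M} {a b : ℕ → M}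
    (hab : a =ᶠ[U] b) (h : UltraRealize U X φ (Fin.snoc (α := fun _ => ℕ → M) v b)) :
    UltraRealize U X φ (Fin.snoc (α := fun _ => ℕ → M) v a) := by
  simp only [UltraRealize, snoc_apply] at h ⊢
  filter_upwards [h, hab] with n hn hn'
  rwa [hn']

/-- A sequence of threads which together form an elementary map, and whose members witness all
existential statements about themselves. Such threads are the elements of a model of NF. -/
structure IsHenkin (U : Ultrafilter ℕ) (X Y : ℕ → M) (c : ℕ → ℕ → ℕ → M) : Prop where
  isPartialElementary : IsPartialElementary U X Y (⋃ k, threadGraph (c k))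
  exists_witness : ∀ {m : ℕ} {Γ : Fin m → ℕ} (i : ℕ)
    (φ : TSTFormula (Fin.snoc (α := fun _ => ℕ) Γ i)) (κ : Fin m → ℕ),
    UltraRealize U X (φ.ex i) (fun x => c (κ x) (Γ x)) →
      ∃ k, UltraRealize U X φ (Fin.snoc (α := fun _ => ℕ → M) (fun x => c (κ x) (Γ x)) (c k i))

theorem exists_isHenkin (hM : IsSetTheoryModel M) {U : Ultrafilter ℕ}
    (hU : (U : Filter ℕ) ≤ Filter.atTop) {X Y : ℕ → M} (hXY : ∀ n, IsPowerset (Y n) (X n))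
    (h0 : IsPartialElementary U X Y ∅) : ∃ c : ℕ → ℕ → ℕ → M, IsHenkin U X Y c := by
  -- The requests for witnesses. They are enumerated with infinite repetition, and a request
  -- is met at a stage at which the threads it mentions have been constructed.
  let ι := Σ (m : ℕ) (Γ : Fin m → ℕ) (i : ℕ),
    TSTFormula (Fin.snoc (α := fun _ => ℕ) Γ i) × (Fin m → ℕ)
  have : Nonempty ι := ⟨⟨0, Fin.elim0, 0, .falsum, Fin.elim0⟩⟩
  obtain ⟨e, he⟩ := exists_surjective_nat ι
  let W : ι → (ℕ → ℕ → ℕ → M) → (ℕ → ℕ → M) → Prop := fun j c d =>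
    UltraRealize U X (j.2.2.2.1.ex j.2.2.1) (fun x => c (j.2.2.2.2 x) (j.2.1 x)) →
      UltraRealize U X j.2.2.2.1 (Fin.snoc (α := fun _ => ℕ → M)
        (fun x => c (j.2.2.2.2 x) (j.2.1 x)) (d j.2.2.1))
  obtain ⟨z, hz, hz'⟩ := hM.exists_ofList (X 0) []
  have step : ∀ (j : ι) (c : ℕ → ℕ → ℕ → M) (R : Set (ℕ × (ℕ → M) × (ℕ → M))),
      IsPartialElementary U X Y R → R.Countable →
        ∃ d, IsPartialElementary U X Y (R ∪ threadGraph d) ∧ W j c d := by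
    intro j c R hR hc
    by_cases h : UltraRealize U X (j.2.2.2.1.ex j.2.2.1) (fun x => c (j.2.2.2.2 x) (j.2.1 x))
    · obtain ⟨a, ha, ha'⟩ := (ultraRealize_ex _ _ _).1 h
      obtain ⟨d, hd, hd'⟩ := hR.exists_thread hU hXY hc ha
      exact ⟨d, hd', fun _ => ha'.congr_snoc hd⟩
    · -- any thread will do, for instance that of the empty object of type `1`
      have hz1 : UltraType U X 1 fun _ => z := Filter.Eventually.of_forall fun n =>
        ⟨hz, fun b hb => absurd ((hz' b).1 hb) List.not_mem_nil⟩
      obtain ⟨d, -, hd'⟩ := hR.exists_thread hU hXY hc hz1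
      exact ⟨d, hd', fun h' => absurd h' h⟩
  have : Nonempty M := ⟨z⟩
  obtain ⟨c, hc⟩ := exists_seq_of_forall_exists_update (α := ℕ → ℕ → M)
    (fun t c => IsPartialElementary U X Y (⋃ s < t, threadGraph (c s)) ∧
      ∀ s < t, (∀ x, (e s.unpair.1).2.2.2.2 x < s) → W (e s.unpair.1) c (c s)) (by
    rintro t c c' hcc ⟨h1, h2⟩
    refine ⟨?_, fun s hs hκ => ?_⟩
    · have : ⋃ s < t, threadGraph (c' s) = ⋃ s < t, threadGraph (c s) :=
        Set.iUnion₂_congr fun s hs => by rw [hcc s hs]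
      rwa [this]
    · have h3 := h2 s hs hκ
      simp only [W, hcc s hs, fun x => hcc _ ((hκ x).trans hs)] at h3
      exact h3) (fun c => by
    refine ⟨by simpa using h0, fun s hs => absurd hs (Nat.not_lt_zero s)⟩) (by
    rintro t c ⟨h1, h2⟩
    obtain ⟨d, hd, hW⟩ := step (e t.unpair.1) c _ h1
      ((Set.finite_Iio t).countable.biUnion fun s _ => Set.countable_range _)
    have hlt : ∀ s < t, Function.update c t d s = c s := fun s hs =>
      Function.update_of_ne hs.ne _ _
    refine ⟨d, hd.mono ?_, fun s hs hκ => ?_⟩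
    · refine Set.iUnion₂_subset fun s hs => ?_
      rcases Nat.lt_succ_iff_lt_or_eq.1 hs with hs | rfl
      · rw [hlt s hs]
        exact (Set.subset_iUnion₂ (s := fun s (_ : s < t) => threadGraph (c s)) s hs).trans
          Set.subset_union_left
      · rw [Function.update_self]
        exact Set.subset_union_right
    · rcases Nat.lt_succ_iff_lt_or_eq.1 hs with hs | rfl
      · simp only [W, hlt s hs, fun x => hlt _ ((hκ x).trans hs)]
        exact h2 s hs hκ
      · simp only [W, Function.update_self, fun x => hlt _ (hκ x)]
        exact hW)
  refine ⟨c, ?_, fun {m Γ} i φ κ h => ?_⟩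
  · have : ⋃ k, threadGraph (c k) = ⋃ t, ⋃ s < t, threadGraph (c s) := by
      ext r
      simp only [Set.mem_iUnion]
      exact ⟨fun ⟨k, hk⟩ => ⟨k + 1, k, Nat.lt_succ_self k, hk⟩, fun ⟨_, k, _, hk⟩ => ⟨k, hk⟩⟩
    rw [this]
    refine isPartialElementary_iUnion (fun t t' htt => ?_) fun t => (hc t).1
    exact Set.biUnion_subset_biUnion_left fun s hs => lt_of_lt_of_le hs htt
  · obtain ⟨k, hk⟩ := he ⟨m, Γ, i, φ, κ⟩
    let t := Nat.pair k (Finset.univ.sup κ + 1)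
    have ht : e t.unpair.1 = ⟨m, Γ, i, φ, κ⟩ := by simp [t, hk]
    have h1 := (hc (t + 1)).2 t (Nat.lt_succ_self t)
    rw [ht] at h1
    exact ⟨t, h1 (fun x => (Nat.lt_succ_of_le (Finset.le_sup (Finset.mem_univ x))).trans_le
      (Nat.right_le_pair _ _)) h⟩

/-! ### Comprehension in natural models -/

/-- The translation of typed formulas into `Δ₀` formulas, where the free variable with index
`2 * i + 1` stands for the set of all objects of type `i`. -/
def TSTFormula.toSetFormula : {m : ℕ} → {Γ : Fin m → ℕ} → TSTFormula Γ → {k : ℕ} →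
    (Fin m → ℕ ⊕ Fin k) → setLang.BoundedFormula ℕ k
  | _, _, .falsum, _, _ => ⊥
  | _, _, .equal x y _, _, f =>
      Language.Term.bdEqual (Language.Term.var (f x)) (Language.Term.var (f y))
  | _, _, .mem x y _, _, f =>
      memSymbol.boundedFormula₂ (Language.Term.var (f x)) (Language.Term.var (f y))
  | _, _, .imp φ ψ, _, f => (φ.toSetFormula f).imp (ψ.toSetFormula f)
  | _, _, .all i φ, k, f => Language.BoundedFormula.all
      ((memSymbol.boundedFormula₂ (n := k + 1) (Language.Term.var (Sum.inr (Fin.last k)))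
        (Language.Term.var (Sum.map id Fin.castSucc (Sum.inl (2 * i + 1))))).imp
          (φ.toSetFormula (Fin.snoc (α := fun _ => ℕ ⊕ Fin (k + 1))
            (fun x => Sum.map id Fin.castSucc (f x)) (Sum.inr (Fin.last k)))))

theorem isDeltaZero_toSetFormula {m : ℕ} {Γ : Fin m → ℕ} (φ : TSTFormula Γ) {k : ℕ}
    (f : Fin m → ℕ ⊕ Fin k) : IsDeltaZero (φ.toSetFormula f) := by
  induction φ generalizing k with
  | falsum => exact .falsum
  | equal => exact .equal _ _
  | mem => exact .rel _ _
  | imp φ ψ ihφ ihψ => exact .imp (ihφ f) (ihψ f)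
  | all i φ ih => exact .ball _ (ih _)

theorem realize_toSetFormula {X : M} {v : ℕ → M}
    (hv : ∀ i a, a ∈ₘ v (2 * i + 1) ↔ NatType X i a) {m : ℕ} {Γ : Fin m → ℕ} (φ : TSTFormula Γ)
    {k : ℕ} (f : Fin m → ℕ ⊕ Fin k) (xs : Fin k → M) :
    (φ.toSetFormula f).Realize v xs ↔ NatRealize X φ fun x => Sum.elim v xs (f x) := by
  induction φ generalizing k with
  | falsum => rfl
  | equal => rfl
  | mem => exact realize_mem _ _ _ _
  | imp φ ψ ihφ ihψ => exact imp_congr (ihφ f xs) (ihψ f xs)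
  | all i φ ih =>
    refine forall_congr' fun a => imp_congr ?_ ((ih _ _).trans (iff_of_eq ?_))
    · refine (realize_mem _ _ _ _).trans (Iff.trans (iff_of_eq ?_) (hv i a))
      simp
    · congr 1
      funext x
      refine Fin.lastCases ?_ (fun y => ?_) x
      · simp
      · simp only [Fin.snoc_castSucc]
        cases f y <;> simp

theorem IsSetTheoryModel.natModel_comprehension (hM : IsSetTheoryModel M) (X : M) {m : ℕ}
    {Γ : Fin (m + 1) → ℕ} (φ : TSTFormula Γ) (w : Fin m → M) :
    ∃ a, NatType X (Γ (Fin.last m) + 1) a ∧ ∀ x, NatType X (Γ (Fin.last m)) x →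
      (x ∈ₘ a ↔ NatRealize X φ (Fin.snoc (α := fun _ => M) w x)) := by
  choose p hp using hM.powerset
  let P : ℕ → M := fun i => p^[i] X
  have hP : ∀ i a, a ∈ₘ P i ↔ NatType X i a := by
    intro i
    induction i with
    | zero => exact fun a => Iff.rfl
    | succ i ih =>
      intro a
      simp only [P, Function.iterate_succ_apply']
      exact ((hp _).2 a).trans (and_congr_right fun _ => forall₂_congr fun b _ => ih b)
  -- The parameter with index `j` is the value of the free variable with index `2 * j + 2`.
  let v : ℕ → M := fun k => if k % 2 = 1 then P (k / 2) else
    if h : k / 2 - 1 < m then w ⟨k / 2 - 1, h⟩ else X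
  obtain ⟨b, hb, h⟩ := hM.separation _ (isDeltaZero_toSetFormula φ (k := 0)
    (Fin.snoc (α := fun _ => ℕ ⊕ Fin 0) (fun j => Sum.inl (2 * j.1 + 2)) (Sum.inl 0))) v
    (P (Γ (Fin.last m)))
  refine ⟨b, ⟨hb, fun x hx => (hP _ x).1 ((h x).1 hx).1⟩, fun x hx => ?_⟩
  rw [h, and_iff_right ((hP _ x).2 hx), Language.Formula.Realize, realize_toSetFormula (X := X)]
  · refine iff_of_eq (congrArg _ (funext fun y => ?_))
    refine Fin.lastCases ?_ (fun j => ?_) y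
    · simp
    · simp [v]
  · intro i a
    have h1 : (2 * i + 1) % 2 = 1 := by omega
    have h2 : (2 * i + 1) / 2 = i := by omega
    rw [Function.update_of_ne (by omega)]
    simp only [v, h1, if_true, h2, hP]

/-! ### The model of NF -/

/-- The interpretation of the symbols of NF given by a binary relation `E`. -/
def nfRelMap {Q : Type*} (E : Q → Q → Prop) : {n : ℕ} → NFRel n → (Fin n → Q) → Prop
  | _, .mem, v => E (v 0) (v 1)

/-- A binary relation as a structure for the language of NF. -/
@[reducible] def nfStructure {Q : Type*} (E : Q → Q → Prop) : nfLang.Structure Q where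
  funMap := fun f => Empty.elim f
  RelMap := fun R => nfRelMap E R

theorem realize_nfMem {Q : Type*} (E : Q → Q → Prop) {m : ℕ}
    (s t : nfLang.Term (Empty ⊕ Fin m)) (v : Empty → Q) (xs : Fin m → Q) :
    letI := nfStructure E
    (nfMem s t).Realize v xs ↔
      E (s.realize (Sum.elim v xs)) (t.realize (Sum.elim v xs)) := by
  let _ := nfStructure E
  exact Language.BoundedFormula.realize_rel₂

/-- `Q`, with the relation `E`, is the structure of the threads `c k`: the thread with index `k` is
represented by `g k`, and equality and membership of threads may be read off at any types. -/
structure Represents (U : Ultrafilter ℕ) (c : ℕ → ℕ → ℕ → M) {Q : Type*} (E : Q → Q → Prop)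
    (g : ℕ → Q) : Prop where
  surjective : Function.Surjective g
  eq_iff : ∀ i s t, g s = g t ↔ c s i =ᶠ[U] c t i
  mem_iff : ∀ i s t, E (g s) (g t) ↔ ∀ᶠ n in U, c s i n ∈ₘ c t (i + 1) n

theorem IsHenkin.ultraType {U : Ultrafilter ℕ} {X Y : ℕ → M} {c : ℕ → ℕ → ℕ → M}
    (hc : IsHenkin U X Y c) (k i : ℕ) : UltraType U X i (c k i) :=
  hc.isPartialElementary.left _ (Set.mem_iUnion.2 ⟨k, i, rfl⟩)

/-- The truth of a formula about threads does not change when all types are raised. -/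
theorem IsHenkin.realize_iff {U : Ultrafilter ℕ} {X Y : ℕ → M} {c : ℕ → ℕ → ℕ → M}
    (hc : IsHenkin U X Y c) {m : ℕ} {Γ : Fin m → ℕ} (φ : TSTFormula Γ) (κ : Fin m → ℕ) :
    UltraRealize U X φ (fun x => c (κ x) (Γ x)) ↔
      UltraRealize U Y φ (fun x => c (κ x) (Γ x + 1)) :=
  hc.isPartialElementary.realize_iff φ _ _ fun x => Set.mem_iUnion.2 ⟨κ x, Γ x, rfl⟩

theorem IsHenkin.eventuallyEq_iff {U : Ultrafilter ℕ} {X Y : ℕ → M} {c : ℕ → ℕ → ℕ → M}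
    (hc : IsHenkin U X Y c) (i s t : ℕ) : c s i =ᶠ[U] c t i ↔ c s 0 =ᶠ[U] c t 0 := by
  induction i with
  | zero => rfl
  | succ i ih =>
    exact (hc.realize_iff (Γ := fun _ : Fin 2 => i) (.equal 0 1 rfl) ![s, t]).symm.trans ih

theorem IsHenkin.eventually_mem_iff {U : Ultrafilter ℕ} {X Y : ℕ → M} {c : ℕ → ℕ → ℕ → M}
    (hc : IsHenkin U X Y c) (i s t : ℕ) : (∀ᶠ n in U, c s i n ∈ₘ c t (i + 1) n) ↔
      ∀ᶠ n in U, c s 0 n ∈ₘ c t 1 n := by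
  induction i with
  | zero => rfl
  | succ i ih =>
    exact (hc.realize_iff (Γ := ![i, i + 1]) (.mem 0 1 rfl) ![s, t]).symm.trans ih

theorem IsHenkin.exists_represents {U : Ultrafilter ℕ} {X Y : ℕ → M} {c : ℕ → ℕ → ℕ → M}
    (hc : IsHenkin U X Y c) :
    ∃ (Q : Type) (E : Q → Q → Prop) (g : ℕ → Q), Represents U c E g := by
  let r : Setoid ℕ := ⟨fun s t => c s 0 =ᶠ[U] c t 0, fun _ => Filter.EventuallyEq.rfl,
    Filter.EventuallyEq.symm (l := (U : Filter ℕ)),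
    Filter.EventuallyEq.trans (l := (U : Filter ℕ))⟩
  have hg : ∀ s t, Quotient.mk r s = Quotient.mk r t ↔ c s 0 =ᶠ[U] c t 0 := fun s t => Quotient.eq
  refine ⟨Quotient r, fun x y => ∃ s t, Quotient.mk r s = x ∧ Quotient.mk r t = y ∧
    ∀ᶠ n in U, c s 0 n ∈ₘ c t 1 n, Quotient.mk r, Quotient.exists_rep, fun i s t =>
      (hg s t).trans (hc.eventuallyEq_iff i s t).symm, fun i s t => ?_⟩
  rw [hc.eventually_mem_iff]
  refine ⟨?_, fun h => ⟨s, t, rfl, rfl, h⟩⟩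
  rintro ⟨s', t', hs, ht, h⟩
  filter_upwards [h, (hg _ _).1 hs, (hc.eventuallyEq_iff 1 _ _).2 ((hg _ _).1 ht)]
    with n hn hn1 hn2
  rwa [hn1, hn2] at hn

/-- A stratified formula holds of threads in the model of NF if and only if the typed formula holds
of the members of the threads in the ultraproduct, whatever types are assigned to the variables. -/
theorem Represents.realize_erase {U : Ultrafilter ℕ} {X Y : ℕ → M} {c : ℕ → ℕ → ℕ → M}
    {Q : Type*} {E : Q → Q → Prop} {g : ℕ → Q} (hg : Represents U c E g)
    (hc : IsHenkin U X Y c) {m : ℕ} {Γ : Fin m → ℕ} (φ : TSTFormula Γ) (κ : Fin m → ℕ)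
    (v : Empty → Q) :
    letI := nfStructure E
    φ.erase.Realize v (fun x => g (κ x)) ↔ UltraRealize U X φ (fun x => c (κ x) (Γ x)) := by
  let _ := nfStructure E
  induction φ with
  | falsum => exact ⟨False.elim, fun h => h.exists.elim fun _ => id⟩
  | @equal m Γ x y h =>
    refine (hg.eq_iff (Γ x) (κ x) (κ y)).trans ?_
    change _ ↔ c (κ x) (Γ x) =ᶠ[U] c (κ y) (Γ y)
    rw [h]
  | @mem m Γ x y h =>
    refine (realize_nfMem E _ _ _ _).trans ((hg.mem_iff (Γ x) (κ x) (κ y)).trans ?_)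
    rw [h]
    rfl
  | imp φ ψ ihφ ihψ => exact (imp_congr (ihφ κ) (ihψ κ)).trans (ultraRealize_imp _ _ _).symm
  | @all m Γ i φ ih =>
    have ih' : ∀ k, φ.erase.Realize v (Fin.snoc (α := fun _ => Q) (fun x => g (κ x)) (g k)) ↔
        UltraRealize U X φ
          (Fin.snoc (α := fun _ => ℕ → M) (fun x => c (κ x) (Γ x)) (c k i)) := by
      intro k
      convert ih (Fin.snoc (α := fun _ => ℕ) κ k) using 2
      · funext x
        refine Fin.lastCases ?_ (fun y => ?_) x <;> simp
      · funext x
        refine Fin.lastCases ?_ (fun y => ?_) x <;> simp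
    refine (hg.surjective.forall.trans (forall_congr' ih')).trans ⟨fun h => ?_, fun h k => ?_⟩
    · by_contra hcon
      obtain ⟨k, hk⟩ := hc.exists_witness i φ.not κ (by
        refine (Ultrafilter.eventually_not.2 hcon).mono fun n hn => (natRealize_ex _ _ _).2 ?_
        by_contra hn'
        exact hn fun a ha => by_contra fun h' => hn' ⟨a, ha, h'⟩)
      exact (ultraRealize_not _ _).1 hk (h k)
    · filter_upwards [h, hc.ultraType k i] with n hn hn'
      rw [snoc_apply]
      exact hn _ hn'

theorem Represents.realize_nfExtensionality (hM : IsSetTheoryModel M) {U : Ultrafilter ℕ}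
    {X Y : ℕ → M} {c : ℕ → ℕ → ℕ → M} {Q : Type*} {E : Q → Q → Prop} {g : ℕ → Q}
    (hg : Represents U c E g) (hc : IsHenkin U X Y c) :
    letI := nfStructure E
    Q ⊨ nfExtensionality := by
  let _ := nfStructure E
  have key : ∀ x y, x = y ↔ ∀ z, E z x ↔ E z y := by
    intro x y
    refine ⟨by rintro rfl; exact fun _ => Iff.rfl, fun h => ?_⟩
    obtain ⟨s, rfl⟩ := hg.surjective x
    obtain ⟨t, rfl⟩ := hg.surjective y
    rw [hg.eq_iff 1]
    by_contra hne
    -- The threads have different members of type `1`, which differ in an object of type `0`.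
    let Δ : Fin 3 → ℕ := Fin.snoc (α := fun _ => ℕ) (fun _ : Fin 2 => 1) 0
    let χ : TSTFormula Δ := .mem 2 0 rfl
    let ψ : TSTFormula Δ := .mem 2 1 rfl
    obtain ⟨k, hk⟩ := hc.exists_witness (Γ := fun _ : Fin 2 => 1) 0
      ((χ.imp ψ).and (ψ.imp χ)).not ![s, t] (by
        filter_upwards [Ultrafilter.eventually_not.2 hne, hc.ultraType s 1, hc.ultraType t 1]
          with n hn hs ht
        rw [natRealize_ex]
        by_contra hcon
        refine hn (hM.extensionality _ _ hs.1 ht.1 fun z => ?_)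
        by_cases hz : NatType (X n) 0 z
        · by_contra hz'
          refine hcon ⟨z, hz, fun h' => hz' ?_⟩
          rw [natRealize_and] at h'
          exact ⟨h'.1, h'.2⟩
        · exact ⟨fun h' => absurd (hs.2 z h') hz, fun h' => absurd (ht.2 z h') hz⟩)
    refine (ultraRealize_not _ _).1 hk ?_
    have h1 := h (g k)
    rw [hg.mem_iff 0, hg.mem_iff 0] at h1
    have h2 := Ultrafilter.eventually_imp.2 h1.1
    have h3 := Ultrafilter.eventually_imp.2 h1.2
    filter_upwards [h2, h3] with n hn2 hn3
    rw [natRealize_and]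
    exact ⟨hn2, hn3⟩
  refine Language.BoundedFormula.realize_alls.2 fun xs => ?_
  rw [Language.BoundedFormula.realize_iff]
  refine (key (xs 0) (xs 1)).trans (forall_congr' fun z => ?_)
  rw [Language.BoundedFormula.realize_iff]
  exact iff_congr
    (realize_nfMem E (.var (.inr 2)) (.var (.inr 0)) default (Fin.snoc (α := fun _ => Q) xs z)).symm
    (realize_nfMem E (.var (.inr 2)) (.var (.inr 1)) default (Fin.snoc (α := fun _ => Q) xs z)).symm

theorem Represents.realize_nfComprehension (hM : IsSetTheoryModel M) {U : Ultrafilter ℕ}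
    {X Y : ℕ → M} {c : ℕ → ℕ → ℕ → M} {Q : Type*} {E : Q → Q → Prop} {g : ℕ → Q}
    (hg : Represents U c E g) (hc : IsHenkin U X Y c) {m : ℕ} {Γ : Fin (m + 1) → ℕ}
    (φ : TSTFormula Γ) :
    letI := nfStructure E
    Q ⊨ nfComprehension φ := by
  let _ := nfStructure E
  refine Language.BoundedFormula.realize_alls.2 fun xs => ?_
  choose κ hκ using fun x => hg.surjective (xs x)
  obtain rfl : (fun x => g (κ x)) = xs := funext hκ
  -- The typed formula `∀ x, x ∈ A ↔ φ`, where `x` has type `i` and `A` has type `i + 1`.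
  let i := Γ (Fin.last m)
  let Γ₀ : Fin m → ℕ := fun x => Γ x.castSucc
  let Δ : Fin (m + 2) → ℕ :=
    Fin.snoc (α := fun _ => ℕ) (Fin.snoc (α := fun _ => ℕ) Γ₀ (i + 1)) i
  let ψ : TSTFormula Δ := φ.rename Δ (Fin.succAbove (Fin.last m).castSucc) (by
    intro x
    refine Fin.lastCases ?_ (fun y => ?_) x
    · simp [Δ, i]
    · simp [Δ, Γ₀, Fin.succAbove_of_castSucc_lt, Fin.castSucc_lt_castSucc_iff,
        Fin.castSucc_lt_last])
  let χ : TSTFormula Δ := .mem (Fin.last (m + 1)) (Fin.last m).castSucc (by simp [Δ])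
  have hθ : ∀ (Z : M) (w : Fin m → M) (a : M),
      NatRealize Z (TSTFormula.all i ((χ.imp ψ).and (ψ.imp χ)))
        (Fin.snoc (α := fun _ => M) w a) ↔
      ∀ x, NatType Z i x → (x ∈ₘ a ↔ NatRealize Z φ (Fin.snoc (α := fun _ => M) w x)) := by
    intro Z w a
    refine forall₂_congr fun x _ => ?_
    have h1 : NatRealize Z χ (Fin.snoc (α := fun _ => M) (Fin.snoc (α := fun _ => M) w a) x) ↔
        x ∈ₘ a := by
      change Fin.snoc (α := fun _ => M) (Fin.snoc (α := fun _ => M) w a) x (Fin.last (m + 1)) ∈ₘ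
        Fin.snoc (α := fun _ => M) (Fin.snoc (α := fun _ => M) w a) x (Fin.last m).castSucc ↔ _
      simp
    have h2 : NatRealize Z ψ (Fin.snoc (α := fun _ => M) (Fin.snoc (α := fun _ => M) w a) x) ↔
        NatRealize Z φ (Fin.snoc (α := fun _ => M) w x) := by
      refine (natRealize_rename _ _ _ _ _).trans (iff_of_eq (congrArg _ (funext fun y => ?_)))
      refine Fin.lastCases ?_ (fun z => ?_) y
      · simp
      · simp [Fin.succAbove_of_castSucc_lt, Fin.castSucc_lt_castSucc_iff, Fin.castSucc_lt_last]
    rw [natRealize_and]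
    exact (and_congr (imp_congr h1 h2) (imp_congr h2 h1)).trans iff_iff_implies_and_implies.symm
  obtain ⟨k, hk⟩ := hc.exists_witness (Γ := Γ₀) (i + 1)
    (TSTFormula.all i ((χ.imp ψ).and (ψ.imp χ))) κ (by
      refine Filter.Eventually.of_forall fun n => (natRealize_ex _ _ _).2 ?_
      obtain ⟨a, ha, ha'⟩ := hM.natModel_comprehension (X n) φ fun x => c (κ x) (Γ₀ x) n
      exact ⟨a, ha, (hθ _ _ _).2 ha'⟩)
  refine Language.BoundedFormula.realize_ex.2 ⟨g k, hg.surjective.forall.2 fun s => ?_⟩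
  rw [Language.BoundedFormula.realize_iff]
  refine (realize_nfMem E _ _ _ _).trans ?_
  have h1 : E (g s) (g k) ↔
      UltraRealize U X φ fun x => c (Fin.snoc (α := fun _ => ℕ) κ s x) (Γ x) := by
    rw [hg.mem_iff i]
    refine Filter.eventually_congr ?_
    filter_upwards [hk, hc.ultraType s i] with n hn hs
    rw [snoc_apply, hθ] at hn
    refine (hn _ hs).trans (iff_of_eq (congrArg _ (funext fun x => ?_)))
    refine Fin.lastCases ?_ (fun y => ?_) x <;> simp [i, Γ₀]
  refine Iff.trans ?_ (h1.trans ((hg.realize_erase hc φ _ default).symm.trans ?_))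
  · simp
  · refine Iff.trans ?_ Language.BoundedFormula.realize_relabel.symm
    refine Iff.trans ?_ (iff_of_eq (congrArg (Language.BoundedFormula.Realize φ.erase.toFormula _)
      (Subsingleton.elim default _)))
    refine Iff.trans (iff_of_eq ?_) (Language.BoundedFormula.realize_toFormula φ.erase _).symm
    congr 1
    funext x
    refine Fin.lastCases ?_ (fun y => ?_) x
    · simp
    · simp [Fin.succAbove_of_castSucc_lt, Fin.castSucc_lt_castSucc_iff, Fin.castSucc_lt_last]

/-- The natural models from ambiguity for finitely many sentences have an ultraproduct that
satisfies full ambiguity, from which a model of NF is obtained. -/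
theorem isSatisfiable_NF (hM : IsSetTheoryModel M)
    (h : ∀ S : Finset TSTSentence, ∃ X : M, ∀ φ ∈ S, (NatModels X φ ↔ NatModels X φ.plus)) :
    NF.IsSatisfiable := by
  classical
  have : Nonempty TSTSentence := ⟨.falsum⟩
  obtain ⟨e, he⟩ := exists_surjective_nat TSTSentence
  choose X hX using fun n => h ((Finset.range n).image e)
  choose Y hXY using fun n => hM.powerset (X n)
  let U := Filter.hyperfilter ℕ
  have hU : (U : Filter ℕ) ≤ Filter.atTop := Nat.hyperfilter_le_atTop
  have h0 : IsPartialElementary U X Y ∅ := by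
    refine ⟨fun r hr => hr.elim, fun r hr => hr.elim, fun {m Γ} φ v w hvw => ?_⟩
    obtain rfl : m = 0 := Nat.eq_zero_of_not_pos fun hm => (hvw ⟨0, hm⟩).elim
    obtain rfl : Γ = Fin.elim0 := Subsingleton.elim _ _
    obtain ⟨k, rfl⟩ := he φ
    refine Filter.eventually_congr ?_
    filter_upwards [hU (Filter.eventually_gt_atTop k)] with n hn
    have h1 := hX n (e k) (Finset.mem_image_of_mem e (Finset.mem_range.2 hn))
    rw [natModels_plus (hXY n)] at h1
    exact (iff_of_eq (congrArg (NatRealize (X n) (e k)) (Subsingleton.elim _ _))).trans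
      (h1.trans (iff_of_eq (congrArg (NatRealize (Y n) (e k)) (Subsingleton.elim _ _))))
  obtain ⟨c, hc⟩ := exists_isHenkin hM hU hXY h0
  obtain ⟨Q, E, g, hg⟩ := hc.exists_represents
  let _ := nfStructure E
  have : Nonempty Q := ⟨g 0⟩
  have : Q ⊨ NF := by
    refine ⟨?_⟩
    rintro σ (rfl | ⟨m, Γ, φ, rfl⟩)
    · exact hg.realize_nfExtensionality hM hc
    · exact hg.realize_nfComprehension hM hc φ
  exact Language.Theory.Model.isSatisfiable Q

end TangledWeb

theorem mainTheorem2 {M : Type*} [TangledWeb.setLang.Structure M]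
    (hM : TangledWeb.IsSetTheoryModel M) (l : M) (τ : M → Set M)
    (hτ : TangledWeb.IsTangledWeb l τ) :
    (∀ S : Finset TangledWeb.TSTSentence,
      ∃ A, TangledWeb.IsIndex l A ∧ ∃ X ∈ τ A,
        ∀ φ ∈ S, (TangledWeb.NatModels X φ ↔ TangledWeb.NatModels X φ.plus)) ∧
    TangledWeb.NF.IsSatisfiable := by
  refine ⟨fun S => hτ.exists_ambiguous hM S, TangledWeb.isSatisfiable_NF hM fun S => ?_⟩
  obtain ⟨A, -, X, -, h⟩ := hτ.exists_ambiguous hM S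
  exact ⟨X, h⟩
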